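/- Let $p$ be an odd prime, let $m\ge 3$ and $l\ge 1$ be integers with $\gcd(m,l)=1$, and put $q=p^m$, $n=q-1$. Write $\mathrm{Tr}$ for the trace from $\mathbb{F}_q$ to $\mathbb{F}_p$ and let $$\mathcal{C}=\{(\mathrm{Tr}(ax^{p^l+1}+bx^2+cx)+h)_{x\in\mathbb{F}_q} : a,b,c\in\mathbb{F}_q,\ h\in\mathbb{F}_p\}.$$ For a primitive element $\alpha$ of $\mathbb{F}_q$, let $\mathcal{C}_1$ be the cyclic code of length $n$ over $\mathbb{F}_p$ whose parity-check polynomial is the product of the minimal polynomials of $\alpha$, $\alpha^2$ and $\alpha^{p^l+1}$ over $\mathbb{F}_p$. For a code $D\subseteq\mathbb{F}_p^n$ let $\overline{D}=\{(c_0,\dots,c_n) : (c_0,\dots,c_{n-1})\in D,\ \sum_{i=0}^n c_i=0\}$ be the extended code, and let $D^\perp$ be the dual of $D$ for the standard inner product. Then, for every primitive element $\alpha$, one has $\mathcal{C}=\overline{\mathcal{C}_1^{\perp}}^{\perp}$, where position $t<n$ is labelled by $x=\alpha^{-t}$ and position $n$ by $x=0$ (a bijection between the positions and $\mathbb{F}_q$).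 The code $\mathcal{C}$ has length $n+1=p^m$ and dimension $3m+1$ over $\mathbb{F}_p$. For every $w\ge 0$, the number $A_w$ of codewords of Hamming weight $w$ is the sum of the multiplicities of all lines of weight $w$ in the following table (and $A_w=0$ if there is no such line). If $m$ is odd: $$\begin{array}{ll} \text{Weight} & \text{Multiplicity}\\ 0 & 1\\ p^{m-1}(p-1) & p(2p^{2m-1}-2p^{2m-2}+p^{2m-3}-p^{2m-4}+p^{m-1}-p^{m-2}+p^{m-3}+1)(p^m-1)\\ p^{\frac{m-1}{2}}(p^{\frac{m+1}{2}}-p^{\frac{m-1}{2}}-p+1) & \frac12 p^{\frac{3m-3}{2}}(p^m-1)(p^{\frac{m-1}{2}}+1)\\ p^{\frac{m-1}{2}}(p^{\frac{m+1}{2}}-p^{\frac{m-1}{2}}+p-1) & \frac12 p^{\frac{3m-3}{2}}(p^m-1)(p^{\frac{m-1}{2}}-1)\\ p^{\frac{m-1}{2}}(p^{\frac{m+1}{2}}-p^{\frac{m-1}{2}}+1) & \frac{p^m(p^m-1)(p^{m+2}-p^{m+1}-p^{m-2}+p^{\frac{m+1}{2}}-p^{\frac{m-3}{2}}+p^2)}{2(p+1)}\\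 p^{\frac{m-1}{2}}(p^{\frac{m+1}{2}}-p^{\frac{m-1}{2}}-1) & \frac{p^m(p^m-1)(p^{m+2}-p^{m+1}-p^{m-2}-p^{\frac{m+1}{2}}+p^{\frac{m-3}{2}}+p^2)}{2(p+1)}\\ p^{\frac{m+1}{2}}(p^{\frac{m-1}{2}}-p^{\frac{m-3}{2}}+1) & \frac12 p^{m-2}(p^m-1)(p^{m-1}-1)/(p+1)\\ p^{\frac{m+1}{2}}(p^{\frac{m-1}{2}}-p^{\frac{m-3}{2}}-1) & \frac12 p^{m-2}(p^m-1)(p^{m-1}-1)/(p+1)\\ p^m & p-1 \end{array}$$ If $m$ is even: $$\begin{array}{ll} \text{Weight} & \text{Multiplicity}\\ 0 & 1\\ p^{m-1}(p-1) & p(p^{2m-1}-p^{2m-2}+2p^{2m-3}-p^{m-2}+1)(p^m-1)\\ p^{\frac{m-2}{2}}(p^{\frac{m+2}{2}}-p^{\frac m2}-p+1) & \frac{p^{m+2}(p^m-1)(p^m-p^{m-1}-p^{m-2}+p^{\frac m2}-p^{\frac{m-2}{2}}+1)}{2(p^2-1)}\\ p^{\frac m2}(p^{\frac m2}-p^{\frac{m-2}{2}}-p+1)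 & \frac12 p^{m-2}(p^m-1)(p^{\frac m2}-1)(p^{\frac{m-2}{2}}+1)/(p^2-1)\\ p^{\frac{m-2}{2}}(p^{\frac{m+2}{2}}-p^{\frac m2}+p-1) & \frac{p^{m+2}(p^m-1)(p^m-p^{m-1}-p^{m-2}-p^{\frac m2}+p^{\frac{m-2}{2}}+1)}{2(p^2-1)}\\ p^{\frac m2}(p^{\frac m2}-p^{\frac{m-2}{2}}+p-1) & \frac12 p^{m-2}(p^m-1)(p^{\frac m2}+1)(p^{\frac{m-2}{2}}-1)/(p^2-1)\\ p^{\frac{m-2}{2}}(p^{\frac{m+2}{2}}-p^{\frac m2}+1) & \frac{p^{m+2}(p^m-1)(p^m-p^{m-1}-p^{m-2}+p^{\frac m2}-p^{\frac{m-2}{2}}+1)}{2(p+1)}\\ p^{\frac m2}(p^{\frac m2}-p^{\frac{m-2}{2}}+1) & \frac{p^{m-2}(p^m-1)(p^{m+2}-p^m+p^{m-1}+p^{\frac m2}-p^{\frac{m-2}{2}}-1)}{2(p+1)}\\ p^{\frac{m-2}{2}}(p^{\frac{m+2}{2}}-p^{\frac m2}-1) & \frac{p^{m+2}(p^m-1)(p^m-p^{m-1}-p^{m-2}-p^{\frac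 m2}+p^{\frac{m-2}{2}}+1)}{2(p+1)}\\ p^{\frac m2}(p^{\frac m2}-p^{\frac{m-2}{2}}-1) & \frac{p^{m-2}(p^m-1)(p^{m+2}-p^m+p^{m-1}-p^{\frac m2}+p^{\frac{m-2}{2}}-1)}{2(p+1)}\\ p^m & p-1 \end{array}$$ The number of distinct nonzero weights that occur is $8$ if $m\ge5$ is odd, $7$ if $m=3$ (two lines of the table then both have weight $p^3$), and $10$ if $m$ is even. -/

import Mathlib

open scoped Polynomial

/-- The cyclic code of length `n` over `K` with parity-check polynomial `h`, i.e. with generator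
polynomial `(X ^ n - 1) / h`. The word `(c_0, ..., c_{n-1})` is identified with the polynomial
`c_0 + c_1 X + ... + c_{n-1} X ^ (n-1)`. -/
noncomputable def cyclicCode {K : Type*} [Field K] (n : ℕ) (h : K[X]) :
    Submodule K (Fin n → K) where
  carrier := {c | (Polynomial.X ^ n - 1) / h ∣
    ∑ i : Fin n, Polynomial.C (c i) * Polynomial.X ^ (i : ℕ)}
  add_mem' := by
    intro a b ha hb
    simp only [Set.mem_ofPred_eq, Pi.add_apply, Polynomial.C_add, add_mul,
      Finset.sum_add_distrib] at *
    exact dvd_add ha hb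
  zero_mem' := by simp
  smul_mem' := by
    intro r a ha
    simp only [Set.mem_ofPred_eq, Pi.smul_apply, smul_eq_mul, Polynomial.C_mul, mul_assoc,
      ← Finset.mul_sum] at *
    exact Dvd.dvd.mul_left ha _

/-- The dual code with respect to the standard inner product. -/
def dualCode {K ι : Type*} [Field K] [Fintype ι] (C : Submodule K (ι → K)) :
    Submodule K (ι → K) where
  carrier := {d | ∀ c ∈ C, ∑ i, c i * d i = 0}
  add_mem' := by
    intro a b ha hb c hc
    simp only [Pi.add_apply, mul_add, Finset.sum_add_distrib, ha c hc, hb c hc, add_zero]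
  zero_mem' := by
    intro c _
    simp
  smul_mem' := by
    intro r a ha c hc
    simp only [Pi.smul_apply, smul_eq_mul, mul_left_comm _ r, ← Finset.mul_sum, ha c hc, mul_zero]

/-- The extended code: all words `(c_0, ..., c_n)` with `(c_0, ..., c_{n-1})` in the code and
`c_0 + ... + c_n = 0`. -/
def extendedCode {K : Type*} [Field K] {n : ℕ} (C : Submodule K (Fin n → K)) :
    Submodule K (Fin (n + 1) → K) where
  carrier := {c | (fun i : Fin n => c i.castSucc) ∈ C ∧ ∑ i, c i = 0}
  add_mem' := by
    rintro a b ⟨ha, ha'⟩ ⟨hb, hb'⟩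
    refine ⟨C.add_mem ha hb, ?_⟩
    simp only [Pi.add_apply, Finset.sum_add_distrib, ha', hb', add_zero]
  zero_mem' := ⟨C.zero_mem, by simp⟩
  smul_mem' := by
    rintro r a ⟨ha, ha'⟩
    refine ⟨C.smul_mem r ha, ?_⟩
    simp only [Pi.smul_apply, smul_eq_mul, ← Finset.mul_sum, ha', mul_zero]

/-- The cyclic code `C₁` of length `p ^ m - 1` over `𝔽_p` whose parity-check polynomial is the
product of the minimal polynomials of `α`, `α ^ 2` and `α ^ (p ^ l + 1)` over `𝔽_p`. -/
noncomputable def codeC1 (p m l : ℕ) [Fact p.Prime] {F : Type*} [Field F] [Algebra (ZMod p) F]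
    (α : F) : Submodule (ZMod p) (Fin (p ^ m - 1) → ZMod p) :=
  cyclicCode (p ^ m - 1)
    (minpoly (ZMod p) α * minpoly (ZMod p) (α ^ 2) * minpoly (ZMod p) (α ^ (p ^ l + 1)))

/-- The code of all words `(Tr(a x^(p^l+1) + b x^2 + c x) + h)_{x ∈ F}`, with `a, b, c ∈ F` and
`h ∈ 𝔽_p`. Its coordinates are indexed by the elements of `F`. -/
noncomputable def traceCode (p l : ℕ) [Fact p.Prime] (F : Type*) [Field F] [Algebra (ZMod p) F] :
    Submodule (ZMod p) (F → ZMod p) where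
  carrier := {w | ∃ (a b c : F) (h : ZMod p), ∀ x : F,
    w x = Algebra.trace (ZMod p) F (a * x ^ (p ^ l + 1) + b * x ^ 2 + c * x) + h}
  add_mem' := by
    rintro w w' ⟨a, b, c, h, hw⟩ ⟨a', b', c', h', hw'⟩
    refine ⟨a + a', b + b', c + c', h + h', fun x => ?_⟩
    simp only [Pi.add_apply, hw, hw', add_mul, map_add]
    ring
  zero_mem' := ⟨0, 0, 0, 0, fun x => by simp⟩
  smul_mem' := by
    rintro r w ⟨a, b, c, h, hw⟩
    refine ⟨r • a, r • b, r • c, r * h, fun x => ?_⟩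
    simp only [Pi.smul_apply, hw, smul_mul_assoc, ← smul_add, map_smul, smul_eq_mul, mul_add]

/-- The field element attached to a coordinate position in `{0, ..., n}`: `α ^ (-t)` for the
position `t < n`, and `0` for the last position `n`. -/
noncomputable def locator {F : Type*} [Field F] (n : ℕ) (α : F) (t : Fin (n + 1)) : F :=
  if (t : ℕ) < n then (α ^ (t : ℕ))⁻¹ else 0

/-- The number `A_w` of words of Hamming weight `w` in a code. -/
noncomputable def weightCount {K ι : Type*} [Field K] [DecidableEq K] [Fintype ι]
    (C : Submodule K (ι → K)) (w : ℕ) : ℕ :=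
  {c : ι → K | c ∈ C ∧ hammingNorm c = w}.ncard

/-- The number of distinct nonzero weights that occur in a code. -/
noncomputable def numNonzeroWeights {K ι : Type*} [Field K] [DecidableEq K] [Fintype ι]
    (C : Submodule K (ι → K)) : ℕ :=
  {w : ℕ | 0 < w ∧ 0 < weightCount C w}.ncard

/-- The total multiplicity of `w` in a table of pairs (weight, multiplicity); lines with the same
weight are added up. -/
def tableMultiplicity (T : List (ℚ × ℚ)) (w : ℚ) : ℚ :=
  ((T.filter (fun r => r.1 = w)).map Prod.snd).sum

/-- The pairs (weight, multiplicity) for odd `m`. All divisions in the exponents are exact, and no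
subtraction in an exponent truncates, when `m ≥ 3` is odd. -/
def oddTable (p : ℚ) (m : ℕ) : List (ℚ × ℚ) :=
  [ (0, 1),
    (p ^ (m - 1) * (p - 1),
      p * (2 * p ^ (2 * m - 1) - 2 * p ^ (2 * m - 2) + p ^ (2 * m - 3) - p ^ (2 * m - 4)
        + p ^ (m - 1) - p ^ (m - 2) + p ^ (m - 3) + 1) * (p ^ m - 1)),
    (p ^ ((m - 1) / 2) * (p ^ ((m + 1) / 2) - p ^ ((m - 1) / 2) - p + 1),
      1 / 2 * p ^ ((3 * m - 3) / 2) * (p ^ m - 1) * (p ^ ((m - 1) / 2) + 1)),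
    (p ^ ((m - 1) / 2) * (p ^ ((m + 1) / 2) - p ^ ((m - 1) / 2) + p - 1),
      1 / 2 * p ^ ((3 * m - 3) / 2) * (p ^ m - 1) * (p ^ ((m - 1) / 2) - 1)),
    (p ^ ((m - 1) / 2) * (p ^ ((m + 1) / 2) - p ^ ((m - 1) / 2) + 1),
      p ^ m * (p ^ m - 1) * (p ^ (m + 2) - p ^ (m + 1) - p ^ (m - 2)
        + p ^ ((m + 1) / 2) - p ^ ((m - 3) / 2) + p ^ 2) / (2 * (p + 1))),
    (p ^ ((m - 1) / 2) * (p ^ ((m + 1) / 2) - p ^ ((m - 1) / 2) - 1),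
      p ^ m * (p ^ m - 1) * (p ^ (m + 2) - p ^ (m + 1) - p ^ (m - 2)
        - p ^ ((m + 1) / 2) + p ^ ((m - 3) / 2) + p ^ 2) / (2 * (p + 1))),
    (p ^ ((m + 1) / 2) * (p ^ ((m - 1) / 2) - p ^ ((m - 3) / 2) + 1),
      1 / 2 * p ^ (m - 2) * (p ^ m - 1) * (p ^ (m - 1) - 1) / (p + 1)),
    (p ^ ((m + 1) / 2) * (p ^ ((m - 1) / 2) - p ^ ((m - 3) / 2) - 1),
      1 / 2 * p ^ (m - 2) * (p ^ m - 1) * (p ^ (m - 1) - 1) / (p + 1)),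
    (p ^ m, p - 1) ]

/-- The pairs (weight, multiplicity) for even `m`. All divisions in the exponents are exact, and no
subtraction in an exponent truncates, when `m ≥ 4` is even. -/
def evenTable (p : ℚ) (m : ℕ) : List (ℚ × ℚ) :=
  [ (0, 1),
    (p ^ (m - 1) * (p - 1),
      p * (p ^ (2 * m - 1) - p ^ (2 * m - 2) + 2 * p ^ (2 * m - 3) - p ^ (m - 2) + 1)
        * (p ^ m - 1)),
    (p ^ ((m - 2) / 2) * (p ^ ((m + 2) / 2) - p ^ (m / 2) - p + 1),
      p ^ (m + 2) * (p ^ m - 1) * (p ^ m - p ^ (m - 1) - p ^ (m - 2)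
        + p ^ (m / 2) - p ^ ((m - 2) / 2) + 1) / (2 * (p ^ 2 - 1))),
    (p ^ (m / 2) * (p ^ (m / 2) - p ^ ((m - 2) / 2) - p + 1),
      1 / 2 * p ^ (m - 2) * (p ^ m - 1) * (p ^ (m / 2) - 1) * (p ^ ((m - 2) / 2) + 1)
        / (p ^ 2 - 1)),
    (p ^ ((m - 2) / 2) * (p ^ ((m + 2) / 2) - p ^ (m / 2) + p - 1),
      p ^ (m + 2) * (p ^ m - 1) * (p ^ m - p ^ (m - 1) - p ^ (m - 2)
        - p ^ (m / 2) + p ^ ((m - 2) / 2) + 1) / (2 * (p ^ 2 - 1))),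
    (p ^ (m / 2) * (p ^ (m / 2) - p ^ ((m - 2) / 2) + p - 1),
      1 / 2 * p ^ (m - 2) * (p ^ m - 1) * (p ^ (m / 2) + 1) * (p ^ ((m - 2) / 2) - 1)
        / (p ^ 2 - 1)),
    (p ^ ((m - 2) / 2) * (p ^ ((m + 2) / 2) - p ^ (m / 2) + 1),
      p ^ (m + 2) * (p ^ m - 1) * (p ^ m - p ^ (m - 1) - p ^ (m - 2)
        + p ^ (m / 2) - p ^ ((m - 2) / 2) + 1) / (2 * (p + 1))),
    (p ^ (m / 2) * (p ^ (m / 2) - p ^ ((m - 2) / 2) + 1),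
      p ^ (m - 2) * (p ^ m - 1) * (p ^ (m + 2) - p ^ m + p ^ (m - 1)
        + p ^ (m / 2) - p ^ ((m - 2) / 2) - 1) / (2 * (p + 1))),
    (p ^ ((m - 2) / 2) * (p ^ ((m + 2) / 2) - p ^ (m / 2) - 1),
      p ^ (m + 2) * (p ^ m - 1) * (p ^ m - p ^ (m - 1) - p ^ (m - 2)
        - p ^ (m / 2) + p ^ ((m - 2) / 2) + 1) / (2 * (p + 1))),
    (p ^ (m / 2) * (p ^ (m / 2) - p ^ ((m - 2) / 2) - 1),
      p ^ (m - 2) * (p ^ m - 1) * (p ^ (m + 2) - p ^ m + p ^ (m - 1)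
        - p ^ (m / 2) + p ^ ((m - 2) / 2) - 1) / (2 * (p + 1))),
    (p ^ m, p - 1) ]

/-! Write `K` for the prime field, `p` for its order, `q` for the order of `F`, and `σ` for `x ↦ x ^
(p ^ l)`. Since `gcd(m, l) = 1`, the fixed field of `σ` is `K`. A codeword is an affine perturbation
`Q(x) + Tr(cx) + h` of a quadratic form `Q(x) = Tr(aσ(x)x + bx²)`, whose polar form is `Tr(L(x)y)`
with `L` self-adjoint. If `c` is not in the range of `L`, a shift along the radical shows that all
values are taken equally often. If `c = L(v)`, completing the square turns the number of zeros into
a level count of `Q`, and `h` runs through all levels. Level counts depend only on the rank and a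
sign (`exists_sign_levelCard_diagonal`), so the weight distribution follows from the joint
distribution of ranks and signs over `(a, b)`.

For `(a, b) ≠ 0` the radical has dimension `d ≤ 2`: if `x, y` lie in it, then `a(xσ(y) - yσ(x))` is
fixed by `σ`, so it lies in `K` (`finrank_ker_tracePolar_le`). Five moments are computed by double
counting: the number of forms, of nonzero radical vectors, of independent pairs of radical vectors,
of zeros, and of zeros weighted by `p ^ d - 1`. The first three determine how many forms have each
`d`. Signs matter only in even rank: this is one unknown difference when `m` is odd and two when `m`
is even, and the last two moments supply them. The tables then become rational-function identities
in `p` and a power of `p` (`RankDistribution.sum_odd`, `RankDistribution.sum_even`).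

For the duality, the words with `h = 0`, punctured at `x = 0`, lie in `C₁` by a geometric sum and
fill it by dimension (`range_puncturedWord`). Dualizing, extending and dualizing again adjoins the
constant words, with last coordinate `h`. -/

set_option linter.unusedSectionVars false

/-! ### Level counts of quadratic forms over a finite field of odd characteristic. -/

section LevelCard

open Finset

/-- The number of points at which a function on a finite type takes the value `t`. -/
def levelCard {X K : Type*} [Fintype X] [DecidableEq K] (f : X → K) (t : K) : ℚ :=
  (#{x | f x = t} : ℚ)

lemma levelCard_eq_sum {X K : Type*} [Fintype X] [DecidableEq K] (f : X → K) (t : K) :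
    levelCard f t = ∑ x, if f x = t then (1 : ℚ) else 0 := by
  simp [levelCard]

lemma levelCard_comp_equiv {X Y K : Type*} [Fintype X] [Fintype Y] [DecidableEq K]
    (e : X ≃ Y) (f : Y → K) (t : K) : levelCard (fun x => f (e x)) t = levelCard f t := by
  rw [levelCard_eq_sum, levelCard_eq_sum]
  exact e.sum_comp (fun y => if f y = t then (1 : ℚ) else 0)

variable {K : Type*} [Field K] [Fintype K] [DecidableEq K]

/-- The deviation from uniformity of the level counts of a quadratic form of rank `r`, up to sign
and scaling. -/
def quadProfile (K : Type*) [Field K] [Fintype K] [DecidableEq K] (r : ℕ) (t : K) : ℚ :=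
  if Even r then (if t = 0 then (Fintype.card K : ℚ) else 0) - 1 else (quadraticChar K t : ℚ)

lemma levelCard_mul_sq (hK : ringChar K ≠ 2) {a : K} (ha : a ≠ 0) (t : K) :
    levelCard (fun y : K => a * y ^ 2) t = 1 + (quadraticChar K (a * t) : ℚ) := by
  have h := quadraticChar_card_sqrts hK (a⁻¹ * t)
  have h2 : quadraticChar K (a⁻¹ * t) = quadraticChar K (a * t) := by
    have : a * t = a⁻¹ * t * a ^ 2 := by field_simp
    rw [this, map_mul _ _ (a ^ 2), quadraticChar_sq_one' ha, mul_one]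
  rw [h2] at h
  have h3 : (univ.filter fun y : K => a * y ^ 2 = t) = {x : K | x ^ 2 = a⁻¹ * t}.toFinset := by
    ext y
    simp only [mem_filter, mem_univ, true_and, Set.mem_toFinset, Set.mem_ofPred_eq]
    constructor
    · rintro rfl; field_simp
    · intro h; rw [h]; field_simp
  rw [levelCard, h3]
  have : ((#{x : K | x ^ 2 = a⁻¹ * t}.toFinset : ℤ) : ℚ) = ((quadraticChar K (a * t) + 1 : ℤ) : ℚ) :=
    congrArg _ h
  push_cast at this
  rw [this, add_comm]

/-- Each `u` is a square `1 + χ(u)` times and `∑ χ(t - au) = 0`, so only `∑ χ(u)χ(t - au)` remains.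
It is elementary for `t = 0`; for `t ≠ 0`, rescaling makes it the Jacobi sum `J(χ, χ) = -χ(-1)`. -/
lemma sum_quadraticChar_sub_mul_sq (hK : ringChar K ≠ 2) {a : K} (ha : a ≠ 0) (t : K) :
    ∑ y : K, quadraticChar K (t - a * y ^ 2) =
      quadraticChar K (-a) * ((if t = 0 then (Fintype.card K : ℤ) else 0) - 1) := by
  have hsq : ∀ f : K → ℤ, ∑ y : K, f (y ^ 2) = ∑ u : K, (quadraticChar K u + 1) * f u := by
    intro f
    rw [← Finset.sum_fiberwise (s := univ) (g := fun y : K => y ^ 2)]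
    refine Finset.sum_congr rfl fun u _ => ?_
    rw [Finset.sum_congr rfl (g := fun _ => f u)
      (by intro y hy; rw [(mem_filter.1 hy).2])]
    rw [sum_const, nsmul_eq_mul, ← quadraticChar_card_sqrts hK u]
    congr 3
    ext; simp
  rw [hsq (fun u => quadraticChar K (t - a * u))]
  have h0 : ∑ u : K, quadraticChar K (t - a * u) = 0 := by
    rw [← quadraticChar_sum_zero hK]
    exact Fintype.sum_bijective (fun u => t - a * u)
      ⟨fun x y h => mul_left_cancel₀ ha (sub_right_injective h),
        fun z => ⟨a⁻¹ * (t - z), by field_simp; ring⟩⟩ _ _ (fun _ => rfl)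
  simp only [add_mul, one_mul, sum_add_distrib, h0, add_zero]
  split_ifs with ht
  · subst ht
    have : ∀ u : K, quadraticChar K u * quadraticChar K (0 - a * u) =
        quadraticChar K (-a) * (if u = 0 then 0 else 1) := by
      intro u
      split_ifs with hu
      · simp [hu]
      · rw [show (0 - a * u) = -a * u by ring, map_mul, mul_left_comm, ← map_mul,
          ← pow_two, quadraticChar_sq_one' hu]
    simp only [this, ← mul_sum]
    congr 1
    have : ∀ u : K, (if u = 0 then (0 : ℤ) else 1) = 1 - if u = 0 then 1 else 0 := by
      intro u; split_ifs <;> simp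
    simp only [this, sum_sub_distrib]
    simp [Finset.card_univ]
  · have hJ : jacobiSum (quadraticChar K) (quadraticChar K) = - quadraticChar K (-1) := by
      have := jacobiSum_nontrivial_inv (quadraticChar_ne_one hK)
      rwa [(quadraticChar_isQuadratic K).inv] at this
    have hsub : ∑ u : K, quadraticChar K u * quadraticChar K (t - a * u) =
        ∑ w : K, quadraticChar K a * (quadraticChar K w * quadraticChar K (1 - w)) := by
      symm
      refine Fintype.sum_bijective (fun w => t * a⁻¹ * w)
        (mulLeft_bijective₀ _ (mul_ne_zero ht (inv_ne_zero ha))) _ _ (fun w => ?_)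
      have e1 : t - a * (t * a⁻¹ * w) = t * (1 - w) := by field_simp
      rw [e1, map_mul, map_mul, map_mul]
      have e2 : quadraticChar K t * quadraticChar K t = 1 := by
        rw [← map_mul, ← pow_two, quadraticChar_sq_one' ht]
      have e3 : quadraticChar K a⁻¹ = quadraticChar K a := by
        rw [← one_mul (quadraticChar K a⁻¹), ← quadraticChar_sq_one' ha, ← map_mul]
        congr 1; field_simp
      rw [e3]
      linear_combination (- quadraticChar K a * quadraticChar K w * quadraticChar K (1 - w)) * e2
    rw [hsub, ← mul_sum]
    change _ * jacobiSum _ _ = _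
    rw [hJ, show -a = a * (-1) by ring, map_mul]
    ring

lemma levelCard_cons {n : ℕ} (w : Fin (n + 1) → K) (t : K) :
    levelCard (fun x : Fin (n + 1) → K => ∑ i, w i * x i ^ 2) t =
      ∑ y : K, levelCard (fun x : Fin n → K => ∑ i, w i.succ * x i ^ 2) (t - w 0 * y ^ 2) := by
  rw [← levelCard_comp_equiv (Fin.consEquiv fun _ => K)]
  simp only [levelCard_eq_sum, Fintype.sum_prod_type, Fin.consEquiv, Equiv.coe_fn_mk,
    Fin.sum_univ_succ, Fin.cons_zero, Fin.cons_succ]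
  refine sum_congr rfl fun y _ => sum_congr rfl fun x _ => ?_
  congr 1
  rw [eq_sub_iff_add_eq, add_comm]

/-- The level counts of a diagonal quadratic form with `r` nonzero coefficients. -/
theorem exists_sign_levelCard_diagonal (hK : ringChar K ≠ 2) : ∀ (n : ℕ) (w : Fin n → K),
    ∃ ε : ℚ, (ε = 1 ∨ ε = -1) ∧ ∀ t : K,
      (Fintype.card K : ℚ) ^ (#{i | w i ≠ 0} / 2 + 1) *
        levelCard (fun x : Fin n → K => ∑ i, w i * x i ^ 2) t =
      (Fintype.card K : ℚ) ^ n *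
        ((Fintype.card K : ℚ) ^ (#{i | w i ≠ 0} / 2) + ε * quadProfile K #{i | w i ≠ 0} t) := by
  intro n
  induction n with
  | zero =>
    intro w
    refine ⟨1, Or.inl rfl, fun t => ?_⟩
    simp [levelCard_eq_sum, quadProfile, eq_comm]
  | succ n ih =>
    intro w
    obtain ⟨ε, hε, h⟩ := ih (fun i => w i.succ)
    set s := #{i : Fin n | w i.succ ≠ 0} with hs
    have hcard : #{i | w i ≠ 0} = (if w 0 ≠ 0 then 1 else 0) + s := by
      rw [Fin.card_filter_univ_succ]
      split_ifs <;> simp [hs, add_comm]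
    by_cases h0 : w 0 = 0
    · refine ⟨ε, hε, fun t => ?_⟩
      rw [levelCard_cons, hcard]
      simp only [h0, ne_eq, not_true_eq_false, if_false, zero_add, zero_mul, sub_zero, sum_const,
        nsmul_eq_mul, card_univ]
      rw [mul_left_comm, h t, pow_succ]
      ring
    · have h1 : (quadraticChar K (w 0) : ℚ) = 1 ∨ (quadraticChar K (w 0) : ℚ) = -1 := by
        rcases quadraticChar_dichotomy h0 with h | h <;> simp [h]
      have h2 : (quadraticChar K (-w 0) : ℚ) = 1 ∨ (quadraticChar K (-w 0) : ℚ) = -1 := by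
        rcases quadraticChar_dichotomy (neg_ne_zero.2 h0) with h | h <;> simp [h]
      have hmul : ∀ x y : ℚ, (x = 1 ∨ x = -1) → (y = 1 ∨ y = -1) →
          (x * y = 1 ∨ x * y = -1) := by
        rintro x y (rfl | rfl) (rfl | rfl) <;> norm_num
      simp only [hcard, ne_eq, h0, not_false_eq_true, if_true]
      -- A further square toggles between the two profiles: summing `p·[t = 0] - 1` over `t - w₀y²`
      -- gives `pχ(w₀)χ(t)`, and summing `χ` gives `χ(-w₀)(p·[t = 0] - 1)`. The sign absorbs the
      -- character value.
      rcases Nat.even_or_odd' s with ⟨k, hk | hk⟩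
      · refine ⟨ε * quadraticChar K (w 0), hmul _ _ hε h1, fun t => ?_⟩
        have hpar : ¬ Even (1 + s) := by rw [hk]; simp [parity_simps]
        have hpar' : Even s := by rw [hk]; simp
        have hd : (1 + s) / 2 = k := by omega
        have hd' : s / 2 = k := by omega
        rw [levelCard_cons, mul_sum, hd]
        simp only [quadProfile, hpar, hpar', hd', if_true, if_false] at h ⊢
        simp only [h, ← mul_sum, sum_add_distrib, sum_sub_distrib, sum_const, nsmul_eq_mul,
          card_univ]
        have : ∑ y : K, (if t - w 0 * y ^ 2 = 0 then (Fintype.card K : ℚ) else 0) =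
            Fintype.card K * (1 + (quadraticChar K (w 0 * t) : ℚ)) := by
          rw [← levelCard_mul_sq hK h0, levelCard_eq_sum, mul_sum]
          refine sum_congr rfl fun y _ => ?_
          simp only [sub_eq_zero, mul_ite, mul_one, mul_zero, eq_comm (a := t)]
        rw [this, map_mul]
        push_cast
        ring
      · refine ⟨ε * quadraticChar K (-w 0), hmul _ _ hε h2, fun t => ?_⟩
        have hpar : Even (1 + s) := by rw [hk]; simp [parity_simps]
        have hpar' : ¬ Even s := by rw [hk]; simp [parity_simps]
        have hd : (1 + s) / 2 = k + 1 := by omega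
        have hd' : s / 2 = k := by omega
        rw [levelCard_cons, hd, pow_succ, mul_comm _ (Fintype.card K : ℚ), mul_assoc, mul_sum]
        simp only [quadProfile, hpar, hpar', hd', if_true, if_false] at h ⊢
        simp only [h, ← mul_sum, sum_add_distrib, sum_const, nsmul_eq_mul, card_univ]
        have : ∑ y : K, (quadraticChar K (t - w 0 * y ^ 2) : ℚ) =
            quadraticChar K (-w 0) * ((if t = 0 then (Fintype.card K : ℚ) else 0) - 1) := by
          have := congrArg (Int.cast : ℤ → ℚ) (sum_quadraticChar_sub_mul_sq hK h0 t)
          push_cast at this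
          exact this
        rw [this]
        ring

/-- The level counts of a quadratic form whose radical has codimension `r`. -/
theorem QuadraticForm.exists_sign_levelCard (hK : ringChar K ≠ 2) {V : Type*} [AddCommGroup V]
    [Module K V] [Fintype V] (Q : QuadraticForm K V) {r k : ℕ}
    (hr : r + k = Module.finrank K V)
    (hrad : #{x : V | ∀ y, QuadraticMap.polar Q x y = 0} = Fintype.card K ^ k)  :
    ∃ ε : ℚ, (ε = 1 ∨ ε = -1) ∧ ∀ t : K,
      (Fintype.card K : ℚ) ^ (r / 2 + 1) * levelCard Q t =
      (Fintype.card K : ℚ) ^ (r + k) *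
        ((Fintype.card K : ℚ) ^ (r / 2) + ε * quadProfile K r t) := by
  have h2 : (2 : K) ≠ 0 := Ring.two_ne_zero hK
  let _ : Invertible (2 : K) := invertibleOfNonzero h2
  obtain ⟨w, ⟨e⟩⟩ := QuadraticForm.equivalent_weightedSumSquares Q
  have hQ : ∀ x, Q x = ∑ i, w i * (e x) i ^ 2 := by
    intro x
    rw [← e.map_app x, QuadraticMap.weightedSumSquares_apply]
    simp [pow_two]
  have hpolar : ∀ x y, QuadraticMap.polar Q x y = ∑ i, 2 * w i * (e x) i * (e y) i := by
    intro x y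
    simp only [QuadraticMap.polar, hQ, ← sum_sub_distrib]
    refine sum_congr rfl fun i _ => ?_
    rw [map_add]
    simp only [Pi.add_apply]
    ring
  -- In diagonal coordinates the radical consists of the vectors supported where `w` vanishes, so
  -- its size gives the number of zero coefficients.
  have hz : #{i | w i = 0} = k := by
    have hb : #{x : V | ∀ y, QuadraticMap.polar Q x y = 0} =
        #(Fintype.piFinset fun i => if w i = 0 then (univ : Finset K) else {0}) := by
      refine card_bij (fun x _ => e x) ?_ ?_ ?_
      · intro x hx
        simp only [mem_filter, mem_univ, true_and] at hx
        rw [Fintype.mem_piFinset]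
        intro i
        split_ifs with hi
        · simp
        · have := hx (e.symm (Pi.single i 1))
          rw [hpolar, sum_eq_single i] at this
          · simpa [h2, hi] using this
          · intro j _ hj
            simp [hj]
          · simp
      · intro x _ y _ h
        exact e.injective h
      · intro z hz
        refine ⟨e.symm z, ?_, by simp⟩
        simp only [mem_filter, mem_univ, true_and]
        intro y
        rw [hpolar]
        refine sum_eq_zero fun i _ => ?_
        have := Fintype.mem_piFinset.1 hz i
        split_ifs at this with hi
        · simp [hi]
        · simp only [mem_singleton] at this
          simp [this]
    rw [hrad, Fintype.card_piFinset] at hb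
    have : ∀ i, #(if w i = 0 then (univ : Finset K) else {0}) =
        if w i = 0 then Fintype.card K else 1 := by
      intro i; split_ifs <;> simp
    simp only [this, prod_ite, prod_const, one_pow, mul_one] at hb
    exact (Nat.pow_right_injective (Fintype.one_lt_card (α := K)) hb).symm
  have hnz : #{i | w i ≠ 0} = r := by
    have := card_filter_add_card_filter_not (s := (univ : Finset (Fin (Module.finrank K V))))
      (fun i => w i = 0)
    rw [hz, card_univ, Fintype.card_fin] at this
    simp only [ne_eq]
    omega
  obtain ⟨ε, hε, h⟩ := exists_sign_levelCard_diagonal hK _ w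
  refine ⟨ε, hε, fun t => ?_⟩
  rw [hnz] at h
  rw [hr, ← h t, ← levelCard_comp_equiv e.toLinearEquiv.toEquiv]
  congr 2
  funext x
  exact hQ x

end LevelCard

/-! ### The trace quadratic forms and their self-adjoint polar maps. -/

section TraceForms

open Finset

variable {K F : Type*} [Field K] [Field F] [Algebra K F]

/-- The quadratic form `x ↦ Tr(a σ(x) x + b x²)`. -/
noncomputable def traceQuadForm (σ : F ≃ₐ[K] F) (a b : F) : QuadraticForm K F :=
  LinearMap.BilinMap.toQuadraticMap ((Algebra.traceForm K F).compLeft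
    (LinearMap.mulLeft K a ∘ₗ σ.toLinearMap + LinearMap.mulLeft K b))

/-- The linear map representing the polar form of `traceQuadForm σ a b` with respect to the trace
form. -/
noncomputable def tracePolar (σ : F ≃ₐ[K] F) (a b : F) : F →ₗ[K] F :=
  LinearMap.mulLeft K a ∘ₗ σ.toLinearMap + σ.symm.toLinearMap ∘ₗ LinearMap.mulLeft K a +
    LinearMap.mulLeft K (2 * b)

lemma traceQuadForm_apply (σ : F ≃ₐ[K] F) (a b x : F) :
    traceQuadForm σ a b x = Algebra.trace K F (a * σ x * x + b * x ^ 2) := by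
  simp only [traceQuadForm, LinearMap.BilinMap.toQuadraticMap_apply,
    LinearMap.BilinForm.compLeft_apply, LinearMap.add_apply, LinearMap.comp_apply,
    LinearMap.mulLeft_apply, AlgEquiv.toLinearMap_apply, Algebra.traceForm_apply]
  congr 1; ring

lemma tracePolar_apply (σ : F ≃ₐ[K] F) (a b x : F) :
    tracePolar σ a b x = a * σ x + σ.symm (a * x) + 2 * b * x := by
  simp [tracePolar, mul_assoc]

/-- The trace is invariant under `σ`, so `Tr(aσ(y)x) = Tr(σ⁻¹(ax)y)`; this frees `y` from `σ`. -/
lemma polar_traceQuadForm (σ : F ≃ₐ[K] F) (a b x y : F) :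
    QuadraticMap.polar (traceQuadForm σ a b) x y =
      Algebra.trace K F (tracePolar σ a b x * y) := by
  rw [traceQuadForm, LinearMap.BilinMap.polar_toQuadraticMap]
  simp only [LinearMap.BilinForm.compLeft_apply, LinearMap.add_apply, LinearMap.comp_apply,
    LinearMap.mulLeft_apply, AlgEquiv.toLinearMap_apply, Algebra.traceForm_apply,
    tracePolar_apply, add_mul, map_add]
  have h : Algebra.trace K F (a * σ y * x) = Algebra.trace K F (σ.symm (a * x) * y) := by
    rw [← Algebra.trace_eq_of_algEquiv σ (σ.symm (a * x) * y), map_mul σ, σ.apply_symm_apply]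
    congr 1; ring
  rw [h, mul_assoc 2 b x, mul_assoc 2 (b * x) y, two_mul, map_add]
  have h2 : b * y * x = b * x * y := by ring
  rw [h2]; abel

lemma traceQuadForm_add (σ : F ≃ₐ[K] F) (a b x v : F) :
    traceQuadForm σ a b (x + v) = traceQuadForm σ a b x + traceQuadForm σ a b v +
      Algebra.trace K F (tracePolar σ a b v * x) := by
  rw [← polar_traceQuadForm, QuadraticMap.polar_comm, QuadraticMap.polar]
  ring

lemma tracePolar_selfAdjoint (σ : F ≃ₐ[K] F) (a b x y : F) :
    Algebra.trace K F (tracePolar σ a b x * y) = Algebra.trace K F (x * tracePolar σ a b y) := by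
  rw [← polar_traceQuadForm, QuadraticMap.polar_comm, polar_traceQuadForm, mul_comm]

/-- In `x·L(y) - y·L(x)` the terms with `b` cancel, and what remains is `a(xσ(y) - yσ(x))` minus its
image under `σ⁻¹`. -/
lemma wronskian_fixed (σ : F ≃ₐ[K] F) {a b x y : F} (hx : tracePolar σ a b x = 0)
    (hy : tracePolar σ a b y = 0) :
    σ (a * (x * σ y - y * σ x)) = a * (x * σ y - y * σ x) := by
  rw [tracePolar_apply] at hx hy
  have h : a * (x * σ y - y * σ x) = σ.symm (a * (x * σ y - y * σ x)) := by
    simp only [map_mul, map_sub, σ.symm_apply_apply] at hx hy ⊢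
    linear_combination x * hy - y * hx
  rw [h, σ.apply_symm_apply, ← h]

variable [FiniteDimensional K F] [Algebra.IsSeparable K F]

lemma eq_zero_of_forall_trace_mul {x : F} (h : ∀ y, Algebra.trace K F (x * y) = 0) : x = 0 :=
  (traceForm_nondegenerate K F).1 x h

/-- An element outside the range of the polar map pairs nontrivially with its kernel. -/
lemma exists_mem_ker_trace_ne_zero (σ : F ≃ₐ[K] F) (a b : F) {c : F}
    (hc : c ∉ LinearMap.range (tracePolar σ a b)) :
    ∃ r, tracePolar σ a b r = 0 ∧ Algebra.trace K F (c * r) ≠ 0 := by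
  by_contra! H
  apply hc
  have hnd := traceForm_nondegenerate K F
  have hrefl : (Algebra.traceForm K F).IsRefl := (Algebra.traceForm_isSymm K).isRefl
  -- The range is its own double orthogonal, and by self-adjointness a vector orthogonal to the
  -- range lies in the kernel.
  rw [← LinearMap.BilinForm.orthogonal_orthogonal hnd hrefl (LinearMap.range _),
    LinearMap.BilinForm.mem_orthogonal_iff]
  intro r hr
  rw [LinearMap.BilinForm.mem_orthogonal_iff] at hr
  have h0 : tracePolar σ a b r = 0 := by
    apply eq_zero_of_forall_trace_mul (K := K)
    intro y
    rw [tracePolar_selfAdjoint, mul_comm]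
    exact hr _ (LinearMap.mem_range_self _ y)
  change Algebra.trace K F (r * c) = 0
  rw [mul_comm]
  exact H r h0

end TraceForms

/-! ### Equidistribution under shifts, and the bound on the radical. -/

section KernelCounts

open Finset

/-- Translations carry any level set onto any other, so all have the same size. -/
lemma card_mul_levelCard_of_shift {X K : Type*} [AddCommGroup X] [Fintype X] [Field K]
    [Fintype K] [DecidableEq K] (f : X → K) {c : K} (hc : c ≠ 0)
    (h : ∀ s : K, ∃ v : X, ∀ x, f (x + v) = f x + s * c) (t : K) :
    (Fintype.card K : ℚ) * levelCard f t = Fintype.card X := by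
  have hconst : ∀ u : K, levelCard f u = levelCard f t := by
    intro u
    obtain ⟨v, hv⟩ := h ((u - t) / c)
    rw [← levelCard_comp_equiv (Equiv.addRight v) f u]
    simp only [Equiv.coe_addRight, hv, div_mul_cancel₀ _ hc]
    rw [levelCard_eq_sum, levelCard_eq_sum]
    refine sum_congr rfl fun x _ => ?_
    congr 1
    rw [← eq_sub_iff_add_eq]
    simp
  have hsum : ∑ u : K, levelCard f u = Fintype.card X := by
    simp only [levelCard_eq_sum]
    rw [sum_comm]
    simp
  rw [← hsum, sum_congr rfl fun u _ => hconst u]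
  simp

variable {K F : Type*} [Field K] [Fintype K] [DecidableEq K] [Field F] [Fintype F] [DecidableEq F]
  [Algebra K F]

lemma card_mul_levelCard_trace (u : F) {c : F} (hc : c ≠ 0) (t : K) :
    (Fintype.card K : ℚ) * levelCard (fun b : F => Algebra.trace K F (u + b * c)) t =
      Fintype.card F := by
  obtain ⟨w, hw⟩ := Algebra.trace_surjective K F 1
  refine card_mul_levelCard_of_shift _ one_ne_zero (fun s => ⟨s • w * c⁻¹, fun x => ?_⟩) t
  have : u + (x + s • w * c⁻¹) * c = (u + x * c) + s • w := by
    field_simp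
    ring
  rw [this, map_add, map_smul, hw, smul_eq_mul]

lemma card_ker_tracePolar (σ : F ≃ₐ[K] F) (a b : F) :
    #{x | tracePolar σ a b x = 0} =
      Fintype.card K ^ Module.finrank K (LinearMap.ker (tracePolar σ a b)) := by
  classical
  rw [← Module.card_eq_pow_finrank, ← Fintype.card_subtype]
  exact Fintype.card_congr (Equiv.subtypeEquivRight fun x => by simp)

lemma finrank_ker_tracePolar_zero (σ : F ≃ₐ[K] F) :
    Module.finrank K (LinearMap.ker (tracePolar σ 0 0)) = Module.finrank K F := by
  have : tracePolar σ 0 0 = 0 := by ext; simp [tracePolar_apply]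
  rw [this, LinearMap.ker_zero, finrank_top]

/-- A vanishing Wronskian says that `y / x` is fixed by `σ`, hence lies in `K`. -/
lemma exists_smul_of_wronskian_eq_zero {σ : F ≃ₐ[K] F}
    (hσ : ∀ x, σ x = x → ∃ c : K, algebraMap K F c = x) {x y : F} (hx : x ≠ 0) (h : x * σ y - y * σ x = 0) :
    ∃ c : K, y = c • x := by
  have hx' : σ x ≠ 0 := by simpa using hx
  obtain ⟨c, hc⟩ := hσ (y / x) (by
    rw [map_div₀, div_eq_div_iff hx' hx]
    linear_combination h)
  exact ⟨c, by rw [Algebra.smul_def, hc, div_mul_cancel₀ _ hx]⟩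

lemma wronskian_eq_zero_iff {σ : F ≃ₐ[K] F}
    (hσ : ∀ x, σ x = x → ∃ c : K, algebraMap K F c = x) {x : F} (hx : x ≠ 0) (y : F) :
    x * σ y - y * σ x = 0 ↔ y ∈ K ∙ x := by
  rw [Submodule.mem_span_singleton]
  constructor
  · intro h
    obtain ⟨c, rfl⟩ := exists_smul_of_wronskian_eq_zero hσ hx h
    exact ⟨c, rfl⟩
  · rintro ⟨c, rfl⟩
    rw [map_smul, Algebra.smul_def, Algebra.smul_def]
    ring

lemma card_wronskian_eq_zero {σ : F ≃ₐ[K] F}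
    (hσ : ∀ x, σ x = x → ∃ c : K, algebraMap K F c = x) {x : F} (hx : x ≠ 0) :
    #{y | x * σ y - y * σ x = 0} = Fintype.card K := by
  classical
  have h := Module.card_eq_pow_finrank (K := K) (V := ↥(K ∙ x))
  rw [finrank_span_singleton hx, pow_one] at h
  rw [← h, ← Fintype.card_subtype]
  exact Fintype.card_congr (Equiv.subtypeEquivRight (wronskian_eq_zero_iff hσ hx))

/-- Fix `x ≠ 0` in the kernel. On the kernel, `y ↦ a(xσ(y) - yσ(x))` takes values in the line `K`
and vanishes only on the line spanned by `x`, so rank-nullity bounds the dimension by `1 + 1`. -/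
lemma finrank_ker_tracePolar_le {σ : F ≃ₐ[K] F}
    (hσ : ∀ x, σ x = x → ∃ c : K, algebraMap K F c = x) (h2 : (2 : F) ≠ 0) {a b : F} (hab : a ≠ 0 ∨ b ≠ 0) :
    Module.finrank K (LinearMap.ker (tracePolar σ a b)) ≤ 2 := by
  by_cases hbot : LinearMap.ker (tracePolar σ a b) = ⊥
  · rw [hbot, finrank_bot]; norm_num
  obtain ⟨x, hx, hx0⟩ := Submodule.exists_mem_ne_zero_of_ne_bot hbot
  -- For `a = 0` the kernel equation reads `2bx = 0`, which would force `b = 0` too.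
  have ha : a ≠ 0 := by
    rintro rfl
    rw [LinearMap.mem_ker, tracePolar_apply] at hx
    simp [h2, hx0] at hx
    simp [hx] at hab
  let φ : LinearMap.ker (tracePolar σ a b) →ₗ[K] F :=
    (LinearMap.mulLeft K (a * x) ∘ₗ σ.toLinearMap - LinearMap.mulLeft K (a * σ x)).domRestrict _
  have hφ : ∀ y, φ y = a * (x * σ y - y * σ x) := by
    intro y
    simp [φ]
    ring
  have hker : Module.finrank K (LinearMap.ker φ) ≤ 1 := by
    have hle : (LinearMap.ker φ).map (LinearMap.ker (tracePolar σ a b)).subtype ≤ K ∙ x := by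
      rintro _ ⟨y, hy, rfl⟩
      have hy' : φ y = 0 := hy
      rw [hφ, mul_eq_zero] at hy'
      exact (wronskian_eq_zero_iff hσ hx0 _).1 (hy'.resolve_left ha)
    have := Submodule.finrank_mono hle
    rwa [finrank_span_singleton hx0, Submodule.finrank_map_subtype_eq] at this
  have hrange : Module.finrank K (LinearMap.range φ) ≤ 1 := by
    have hle : LinearMap.range φ ≤ K ∙ (1 : F) := by
      rintro _ ⟨y, rfl⟩
      obtain ⟨c, hc⟩ := hσ (φ y) (by rw [hφ]; exact wronskian_fixed σ hx y.2)
      rw [Submodule.mem_span_singleton]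
      exact ⟨c, by rw [← hc, Algebra.smul_def, mul_one]⟩
    have := Submodule.finrank_mono hle
    rwa [finrank_span_singleton one_ne_zero] at this
  have := LinearMap.finrank_range_add_finrank_ker φ
  omega

end KernelCounts

/-! ### Moments of the family of forms by double counting. -/

section MomentSums

open Finset

variable {K F : Type*} [Field K] [Fintype K] [DecidableEq K] [Field F] [Fintype F] [DecidableEq F]
  [Algebra K F]

/-- The dimension of the radical of `traceQuadForm σ a b`. -/
noncomputable def radDim (σ : F ≃ₐ[K] F) (a b : F) : ℕ :=
  Module.finrank K (LinearMap.ker (tracePolar σ a b))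

/-- The unique `b` for which `x` lies in the radical of `traceQuadForm σ a b`. -/
noncomputable def radCoeff (σ : F ≃ₐ[K] F) (a x : F) : F :=
  -(a * σ x + σ.symm (a * x)) / (2 * x)

lemma tracePolar_eq_zero_iff (σ : F ≃ₐ[K] F) (h2 : (2 : F) ≠ 0) (a b : F) {x : F} (hx : x ≠ 0) :
    tracePolar σ a b x = 0 ↔ b = radCoeff σ a x := by
  rw [tracePolar_apply, radCoeff, eq_div_iff (mul_ne_zero h2 hx)]
  constructor <;> intro h <;> linear_combination h

lemma pow_radDim_sub_one (σ : F ≃ₐ[K] F) (a b : F) :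
    (Fintype.card K : ℚ) ^ radDim σ a b - 1 =
      ∑ x ∈ univ.erase (0 : F), if tracePolar σ a b x = 0 then (1 : ℚ) else 0 := by
  have h := card_ker_tracePolar σ a b
  have h' : ((#{x | tracePolar σ a b x = 0} : ℕ) : ℚ) = (Fintype.card K : ℚ) ^ radDim σ a b := by
    rw [h]; push_cast; rfl
  have h'' : ((#{x | tracePolar σ a b x = 0} : ℕ) : ℚ) =
      ∑ x, if tracePolar σ a b x = 0 then (1 : ℚ) else 0 := by simp
  rw [← h', h'', ← add_sum_erase univ _ (mem_univ (0 : F))]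
  simp

/-- Double counting of forms together with a nonzero radical vector `x`: given `x` and `a`, exactly
one `b` works. -/
lemma sum_pow_radDim_mul (σ : F ≃ₐ[K] F) (h2 : (2 : F) ≠ 0) (g : F → F → ℚ) :
    ∑ a : F, ∑ b : F, ((Fintype.card K : ℚ) ^ radDim σ a b - 1) * g a b =
      ∑ x ∈ univ.erase (0 : F), ∑ a : F, g a (radCoeff σ a x) := by
  simp only [pow_radDim_sub_one, sum_mul]
  rw [sum_congr rfl fun a _ => sum_comm, sum_comm]
  refine sum_congr rfl fun x hx => sum_congr rfl fun a _ => ?_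
  simp [tracePolar_eq_zero_iff σ h2 _ _ (ne_of_mem_erase hx)]

lemma sum_pow_radDim (σ : F ≃ₐ[K] F) (h2 : (2 : F) ≠ 0) :
    ∑ a : F, ∑ b : F, ((Fintype.card K : ℚ) ^ radDim σ a b - 1) =
      (Fintype.card F - 1) * Fintype.card F := by
  have h := sum_pow_radDim_mul σ h2 (fun _ _ => 1)
  simp only [mul_one] at h
  rw [h]
  simp [card_erase_of_mem, Nat.cast_sub Fintype.card_pos]

/-- The summand counts ordered pairs of independent radical vectors. For independent `x, y` with `b`
fixed by `x`, the vector `y` is in the radical exactly when `a(xσ(y) - yσ(x))` lies in `K`, which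
leaves `|K|` choices of `a`. -/
lemma sum_radDim_pairs {σ : F ≃ₐ[K] F} (hσ : ∀ x, σ x = x → ∃ c : K, algebraMap K F c = x)
    (h2 : (2 : F) ≠ 0) :
    ∑ a : F, ∑ b : F, ((Fintype.card K : ℚ) ^ radDim σ a b - 1) *
        ((Fintype.card K : ℚ) ^ radDim σ a b - Fintype.card K) =
      (Fintype.card F - 1) * (Fintype.card F - Fintype.card K) * Fintype.card K := by
  rw [sum_pow_radDim_mul σ h2 fun a b => ((Fintype.card K : ℚ) ^ radDim σ a b - Fintype.card K)]
  have key : ∀ x ∈ univ.erase (0 : F),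
      ∑ a : F, ((Fintype.card K : ℚ) ^ radDim σ a (radCoeff σ a x) - Fintype.card K) =
        (Fintype.card F - Fintype.card K) * Fintype.card K := by
    intro x hx
    have hx0 := ne_of_mem_erase hx
    -- The multiples of `x` always lie in the radical, and removing them accounts for the subtracted
    -- `|K|`.
    have hsub : ∀ a : F, ((Fintype.card K : ℚ) ^ radDim σ a (radCoeff σ a x) - Fintype.card K) =
        ∑ y ∈ univ.filter (fun y => ¬ x * σ y - y * σ x = 0),
          if tracePolar σ a (radCoeff σ a x) y = 0 then (1 : ℚ) else 0 := by
      intro a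
      have h0 := (tracePolar_eq_zero_iff σ h2 a _ hx0).2 rfl
      have e1 : (Fintype.card K : ℚ) ^ radDim σ a (radCoeff σ a x) =
          ∑ y : F, if tracePolar σ a (radCoeff σ a x) y = 0 then (1 : ℚ) else 0 := by
        rw [radDim, ← Nat.cast_pow, ← card_ker_tracePolar]
        simp
      rw [e1, ← sum_filter_add_sum_filter_not univ (fun y => x * σ y - y * σ x = 0), add_comm,
        add_sub_assoc, add_eq_left, sub_eq_zero]
      rw [← card_wronskian_eq_zero hσ hx0, card_eq_sum_ones]
      push_cast
      refine sum_congr rfl fun y hy => ?_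
      obtain ⟨c, rfl⟩ := exists_smul_of_wronskian_eq_zero hσ hx0 (mem_filter.1 hy).2
      simp [h0]
    simp only [hsub]
    rw [sum_comm]
    have hin : ∀ y ∈ univ.filter (fun y => ¬ x * σ y - y * σ x = 0),
        ∑ a : F, (if tracePolar σ a (radCoeff σ a x) y = 0 then (1 : ℚ) else 0) =
          Fintype.card K := by
      intro y hy
      have hD := (mem_filter.1 hy).2
      have hiff : ∀ a : F, tracePolar σ a (radCoeff σ a x) y = 0 ↔
          ∃ c : K, algebraMap K F c / (x * σ y - y * σ x) = a := by
        intro a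
        have h0 := (tracePolar_eq_zero_iff σ h2 a _ hx0).2 rfl
        constructor
        · intro hy0
          obtain ⟨c, hc⟩ := hσ _ (wronskian_fixed σ h0 hy0)
          exact ⟨c, by rw [hc, mul_div_cancel_right₀ _ hD]⟩
        · rintro ⟨c, hc⟩
          have hfix : a * (x * σ y - y * σ x) = σ.symm (a * (x * σ y - y * σ x)) := by
            rw [← hc, div_mul_cancel₀ _ hD, AlgEquiv.commutes]
          rw [tracePolar_apply] at h0 ⊢
          apply mul_left_cancel₀ hx0
          simp only [map_mul, map_sub, σ.symm_apply_apply] at hfix h0 ⊢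
          linear_combination hfix + y * h0
      simp only [hiff]
      rw [sum_boole]
      have himg : univ.filter (fun a => ∃ c : K, algebraMap K F c / (x * σ y - y * σ x) = a) =
          univ.image (fun c : K => algebraMap K F c / (x * σ y - y * σ x)) := by
        ext; simp
      rw [himg, card_image_of_injective, card_univ]
      intro c c' h
      exact (algebraMap K F).injective ((div_left_inj' hD).1 h)
    rw [sum_congr rfl hin, sum_const, nsmul_eq_mul]
    congr 1
    have := card_filter_add_card_filter_not (s := (univ : Finset F))
      (fun y => x * σ y - y * σ x = 0)
    rw [card_wronskian_eq_zero hσ hx0, card_univ] at this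
    rw [← this]
    push_cast
    ring
  rw [sum_congr rfl key]
  simp [card_erase_of_mem, Nat.cast_sub Fintype.card_pos, mul_assoc]

/-- After exchanging sums, `x = 0` is a zero of every form, while for `x ≠ 0` the value is
equidistributed as `b` varies. -/
lemma sum_levelCard_zero (σ : F ≃ₐ[K] F) :
    (Fintype.card K : ℚ) * ∑ a : F, ∑ b : F, levelCard (traceQuadForm σ a b) (0 : K) =
      Fintype.card K * (Fintype.card F : ℚ) ^ 2 +
        (Fintype.card F - 1) * (Fintype.card F : ℚ) ^ 2 := by
  have hswap : ∑ a : F, ∑ b : F, levelCard (traceQuadForm σ a b) (0 : K) =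
      ∑ x : F, ∑ a : F,
        levelCard (fun b : F => Algebra.trace K F (a * σ x * x + b * x ^ 2)) (0 : K) := by
    simp only [levelCard_eq_sum, traceQuadForm_apply]
    rw [sum_congr rfl fun a _ => sum_comm, sum_comm]
  rw [hswap, ← add_sum_erase univ _ (mem_univ (0 : F)), mul_add]
  congr 1
  · simp [levelCard, pow_two]
  · have : ∀ x ∈ univ.erase (0 : F), (Fintype.card K : ℚ) * ∑ a : F,
        levelCard (fun b : F => Algebra.trace K F (a * σ x * x + b * x ^ 2)) (0 : K) =
          (Fintype.card F : ℚ) ^ 2 := by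
      intro x hx
      rw [mul_sum, sum_congr rfl fun a _ =>
        card_mul_levelCard_trace _ (pow_ne_zero 2 (ne_of_mem_erase hx)) _]
      simp [pow_two]
    rw [mul_sum, sum_congr rfl this]
    simp [card_erase_of_mem, Nat.cast_sub Fintype.card_pos]

/-- Eliminating `b` and moving `σ⁻¹` across the trace completes a square in `σ(u) - u`. The result
is linear in `a`, and the summand `0` fits the shape of `card_mul_levelCard_trace`. -/
lemma traceQuadForm_radCoeff (σ : F ≃ₐ[K] F) (h2 : (2 : F) ≠ 0) (a u : F) {x : F} (hx : x ≠ 0) :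
    traceQuadForm σ a (radCoeff σ a x) (x * u) =
      Algebra.trace K F (0 + a * (-(x * σ x * (σ u - u) ^ 2) / 2)) := by
  have h : Algebra.trace K F (σ.symm (a * x) * x * u ^ 2 / 2) =
      Algebra.trace K F (a * x * σ x * σ u ^ 2 / 2) := by
    rw [← Algebra.trace_eq_of_algEquiv σ]
    simp only [map_div₀, map_mul, map_pow, σ.apply_symm_apply, map_ofNat]
  rw [traceQuadForm_apply]
  have e1 : a * σ (x * u) * (x * u) + radCoeff σ a x * (x * u) ^ 2 =
      a * x * σ x * σ u * u - a * x * σ x * u ^ 2 / 2 - σ.symm (a * x) * x * u ^ 2 / 2 := by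
    rw [radCoeff, map_mul]
    field_simp
    ring
  rw [e1, map_sub, h, ← map_sub]
  congr 1
  field_simp
  ring

/-- Fix a radical vector `x` and write points as `xu`. For `u` in `K` the form vanishes at `xu`
whatever `a` is; for every other `u` its value is equidistributed in `a`. -/
lemma sum_pow_radDim_mul_levelCard {σ : F ≃ₐ[K] F}
    (hσ : ∀ x, σ x = x → ∃ c : K, algebraMap K F c = x) (h2 : (2 : F) ≠ 0) :
    (Fintype.card K : ℚ) * ∑ a : F, ∑ b : F, ((Fintype.card K : ℚ) ^ radDim σ a b - 1) *
        levelCard (traceQuadForm σ a b) (0 : K) =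
      (Fintype.card F - 1) * ((Fintype.card K : ℚ) ^ 2 * Fintype.card F +
        (Fintype.card F - Fintype.card K) * Fintype.card F) := by
  rw [sum_pow_radDim_mul σ h2, mul_sum]
  have key : ∀ x ∈ univ.erase (0 : F), (Fintype.card K : ℚ) *
      ∑ a : F, levelCard (traceQuadForm σ a (radCoeff σ a x)) (0 : K) =
        (Fintype.card K : ℚ) ^ 2 * Fintype.card F +
        (Fintype.card F - Fintype.card K) * Fintype.card F := by
    intro x hx
    have hx0 := ne_of_mem_erase hx
    have hswap : ∑ a : F, levelCard (traceQuadForm σ a (radCoeff σ a x)) (0 : K) =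
        ∑ u : F, levelCard (fun a : F =>
          Algebra.trace K F (0 + a * (-(x * σ x * (σ u - u) ^ 2) / 2))) (0 : K) := by
      simp only [← traceQuadForm_radCoeff σ h2 _ _ hx0]
      rw [sum_congr rfl fun a _ => (levelCard_comp_equiv (Equiv.mulLeft₀ x hx0) _ _).symm]
      simp only [levelCard_eq_sum]
      rw [sum_comm]
      rfl
    have hfix : #{u : F | σ u - u = 0} = Fintype.card K := by
      rw [← card_wronskian_eq_zero hσ one_ne_zero]
      simp
    rw [hswap, ← sum_filter_add_sum_filter_not univ (fun u => σ u - u = 0), mul_add]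
    congr 1
    · rw [sum_congr rfl (g := fun _ => (Fintype.card F : ℚ)), sum_const, hfix]
      · simp only [nsmul_eq_mul]; ring
      · intro u hu
        rw [(mem_filter.1 hu).2]
        simp [levelCard]
    · rw [mul_sum, sum_congr rfl (g := fun _ => (Fintype.card F : ℚ)), sum_const]
      · have := card_filter_add_card_filter_not (s := (univ : Finset F)) (fun u => σ u - u = 0)
        rw [hfix, card_univ] at this
        have : ((#{u : F | ¬ σ u - u = 0} : ℕ) : ℚ) = Fintype.card F - Fintype.card K := by
          rw [← this]; push_cast; ring
        rw [nsmul_eq_mul, this]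
      · intro u hu
        have hu' := (mem_filter.1 hu).2
        have : -(x * σ x * (σ u - u) ^ 2) / 2 ≠ 0 := by
          refine div_ne_zero (neg_ne_zero.2 (mul_ne_zero (mul_ne_zero hx0 ?_) (pow_ne_zero 2 hu')))
            h2
          simpa using hx0
        exact card_mul_levelCard_trace _ this _
  rw [sum_congr rfl key]
  simp [card_erase_of_mem, Nat.cast_sub Fintype.card_pos, mul_add]

end MomentSums

/-! ### Zeros of a form perturbed by an affine function. -/

section Perturbation

open Finset

variable {K F : Type*} [Field K] [Fintype K] [DecidableEq K] [Field F] [Fintype F] [DecidableEq F]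
  [Algebra K F]

/-- Some radical vector `r` has `Tr(cr) ≠ 0`. The form vanishes on the line of `r` because the
characteristic is odd, so moving along it changes only the linear term. -/
lemma card_mul_levelCard_perturbed (σ : F ≃ₐ[K] F) (a b : F) {c : F}
    (hc : c ∉ LinearMap.range (tracePolar σ a b)) (h t : K) (h2 : (2 : K) ≠ 0) :
    (Fintype.card K : ℚ) *
      levelCard (fun x => traceQuadForm σ a b x + Algebra.trace K F (c * x) + h) t =
      Fintype.card F := by
  obtain ⟨r, hr, hcr⟩ := exists_mem_ker_trace_ne_zero σ a b hc
  refine card_mul_levelCard_of_shift _ hcr (fun s => ⟨s • r, fun x => ?_⟩) t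
  have hQ : traceQuadForm σ a b (s • r) = 0 := by
    have := QuadraticMap.polar_self (traceQuadForm σ a b) r
    rw [polar_traceQuadForm, hr] at this
    rw [QuadraticMap.map_smul]
    simp at this
    simp [this.resolve_left h2]
  rw [traceQuadForm_add, hQ, map_smul, hr, mul_add, map_add, mul_smul_comm, map_smul]
  simp only [smul_zero, zero_mul, map_zero, smul_eq_mul]
  ring

/-- Completing the square: `Q(x) + Tr(L(v)x) = Q(x + v) - Q(v)`. -/
lemma levelCard_perturbed (σ : F ≃ₐ[K] F) (a b v : F) (h : K) :
    levelCard (fun x => traceQuadForm σ a b x + Algebra.trace K F (tracePolar σ a b v * x) + h) 0 =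
      levelCard (traceQuadForm σ a b) (traceQuadForm σ a b v - h) := by
  rw [← levelCard_comp_equiv (Equiv.addRight v) (traceQuadForm σ a b), levelCard_eq_sum,
    levelCard_eq_sum]
  refine sum_congr rfl fun x _ => ?_
  simp only [Equiv.coe_addRight, traceQuadForm_add]
  congr 1
  rw [eq_iff_iff]
  constructor <;> intro h <;> linear_combination h

/-- The range of `L` has `|K| ^ r` elements. For `c = L(v)` the level `Q(v) - h` runs through `K`
with `h`; every other `c` gives uniform counts. Leaving `φ` arbitrary lets an indicator be inserted
later. -/
lemma sum_perturbed (σ : F ≃ₐ[K] F) (a b : F) {r : ℕ}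
    (hr : r + radDim σ a b = Module.finrank K F) (h2 : (2 : K) ≠ 0) (φ : ℚ → ℚ) :
    ∑ c : F, ∑ h : K,
      φ (levelCard (fun x => traceQuadForm σ a b x + Algebra.trace K F (c * x) + h) 0) =
      (Fintype.card F - (Fintype.card K : ℚ) ^ r) * Fintype.card K *
          φ (Fintype.card F / Fintype.card K) +
        (Fintype.card K : ℚ) ^ r * ∑ t : K, φ (levelCard (traceQuadForm σ a b) t) := by
  classical
  have hK : (Fintype.card K : ℚ) ≠ 0 := by simp
  have hrange : #{c : F | c ∈ LinearMap.range (tracePolar σ a b)} = Fintype.card K ^ r := by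
    have h := Module.card_eq_pow_finrank (K := K) (V := LinearMap.range (tracePolar σ a b))
    have h' := LinearMap.finrank_range_add_finrank_ker (tracePolar σ a b)
    rw [← hr, radDim, Nat.add_right_cancel_iff] at h'
    rw [← h', ← h, ← Fintype.card_subtype]
  have hnot : ((#{c : F | c ∉ LinearMap.range (tracePolar σ a b)} : ℕ) : ℚ) =
      Fintype.card F - (Fintype.card K : ℚ) ^ r := by
    have := card_filter_add_card_filter_not (s := (univ : Finset F))
      (fun c => c ∈ LinearMap.range (tracePolar σ a b))
    rw [hrange, card_univ] at this
    rw [← this]; push_cast; ring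
  rw [← sum_filter_add_sum_filter_not univ (fun c => c ∈ LinearMap.range (tracePolar σ a b)),
    add_comm]
  congr 1
  · rw [sum_congr rfl (g := fun _ => (Fintype.card K : ℚ) * φ (Fintype.card F / Fintype.card K)),
      sum_const, nsmul_eq_mul, hnot, mul_assoc]
    intro c hc
    rw [sum_congr rfl (g := fun _ => φ (Fintype.card F / Fintype.card K)), sum_const]
    · simp
    · intro h _
      congr 1
      rw [eq_div_iff hK, mul_comm]
      exact card_mul_levelCard_perturbed σ a b (mem_filter.1 hc).2 h 0 h2
  · rw [sum_congr rfl (g := fun _ => ∑ t : K, φ (levelCard (traceQuadForm σ a b) t)),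
      sum_const, nsmul_eq_mul, hrange]
    · push_cast; ring
    · intro c hc
      obtain ⟨v, rfl⟩ := LinearMap.mem_range.1 (mem_filter.1 hc).2
      simp only [levelCard_perturbed]
      exact (Equiv.subLeft (traceQuadForm σ a b v)).sum_comp
        (fun t => φ (levelCard (traceQuadForm σ a b) t))

lemma exists_sign_levelCard_traceQuadForm (hK : ringChar K ≠ 2) (σ : F ≃ₐ[K] F) (a b : F)
    {r : ℕ} (hr : r + radDim σ a b = Module.finrank K F) :
    ∃ ε : ℚ, (ε = 1 ∨ ε = -1) ∧ ∀ t : K, levelCard (traceQuadForm σ a b) t =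
      (Fintype.card F : ℚ) * ((Fintype.card K : ℚ) ^ (r / 2) + ε * quadProfile K r t) /
        (Fintype.card K : ℚ) ^ (r / 2 + 1) := by
  obtain ⟨ε, hε, h⟩ := QuadraticForm.exists_sign_levelCard hK (traceQuadForm σ a b) hr (by
    rw [radDim, ← card_ker_tracePolar]
    congr 1
    ext x
    simp only [mem_filter, mem_univ, true_and, polar_traceQuadForm]
    exact ⟨fun H => eq_zero_of_forall_trace_mul H, fun H y => by simp [H]⟩)
  refine ⟨ε, hε, fun t => ?_⟩
  rw [eq_div_iff (by simp), mul_comm, h t, hr, Module.card_eq_pow_finrank (K := K) (V := F)]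
  push_cast
  rfl

lemma sum_quadProfile (hK : ringChar K ≠ 2) (r : ℕ) (ψ : ℚ → ℚ) :
    ∑ t : K, ψ (quadProfile K r t) =
      if Even r then ψ (Fintype.card K - 1) + (Fintype.card K - 1) * ψ (-1)
      else ψ 0 + (Fintype.card K - 1) / 2 * (ψ 1 + ψ (-1)) := by
  have hc : ((#(univ.erase (0 : K)) : ℕ) : ℚ) = Fintype.card K - 1 := by
    simp [card_erase_of_mem, Nat.cast_sub Fintype.card_pos]
  rw [← add_sum_erase univ _ (mem_univ (0 : K))]
  split_ifs with hr
  · simp only [quadProfile, hr, if_true]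
    congr 1
    rw [sum_congr rfl (g := fun _ => ψ (-1)), sum_const, nsmul_eq_mul, hc]
    intro t ht
    simp [ne_of_mem_erase ht]
  · simp only [quadProfile, hr, if_false, MulChar.map_zero, Int.cast_zero]
    congr 1
    -- Off zero the character is `±1`, so `ψ` may be replaced by its affine interpolation, whose
    -- linear part sums to zero.
    have hlin : ∀ t ∈ univ.erase (0 : K), ψ (quadraticChar K t : ℚ) =
        (ψ 1 + ψ (-1)) / 2 + (quadraticChar K t : ℚ) * ((ψ 1 - ψ (-1)) / 2) := by
      intro t ht
      rcases quadraticChar_dichotomy (ne_of_mem_erase ht) with h | h <;> rw [h] <;> push_cast <;>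
        ring
    have h0 : ∑ t ∈ univ.erase (0 : K), (quadraticChar K t : ℚ) = 0 := by
      rw [← Int.cast_sum, sum_erase _ (by simp), quadraticChar_sum_zero hK, Int.cast_zero]
    rw [sum_congr rfl hlin, sum_add_distrib, ← sum_mul, h0, sum_const, nsmul_eq_mul, hc]
    ring

/-- The number of zeros attached to a form of rank `r`, profile value `s` and sign `e`. -/
noncomputable def zeroCount (p : ℚ) (q : ℚ) (r : ℕ) (s : ℚ) : ℚ :=
  q * (p ^ (r / 2) + s) / p ^ (r / 2 + 1)

/-- The contribution of a form of rank `r` and sign `e` to a sum over zero counts. -/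
noncomputable def formContribution (p q : ℚ) (φ : ℚ → ℚ) (r : ℕ) (e : ℚ) : ℚ :=
  (q - p ^ r) * p * φ (q / p) + p ^ r *
    if Even r then φ (zeroCount p q r (e * (p - 1))) + (p - 1) * φ (zeroCount p q r (-e))
    else φ (q / p) + (p - 1) / 2 * (φ (zeroCount p q r 1) + φ (zeroCount p q r (-1)))

/-- The number of zeros of a form of rank `r` and sign `e`. -/
noncomputable def formZeros (p q : ℚ) (r : ℕ) (e : ℚ) : ℚ :=
  if Even r then zeroCount p q r (e * (p - 1)) else q / p

/-- One sign serves both the zeros of the form and every `φ`. In odd rank it drops out, because the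
profile takes the values `1` and `-1` equally often. -/
lemma sum_perturbed_eq_formContribution (hK : ringChar K ≠ 2) (σ : F ≃ₐ[K] F) (a b : F) :
    ∃ ε : ℚ, (ε = 1 ∨ ε = -1) ∧
      levelCard (traceQuadForm σ a b) 0 =
        formZeros (Fintype.card K) (Fintype.card F) (Module.finrank K F - radDim σ a b) ε ∧
      ∀ φ : ℚ → ℚ, ∑ c : F, ∑ h : K,
        φ (levelCard (fun x => traceQuadForm σ a b x + Algebra.trace K F (c * x) + h) 0) =
          formContribution (Fintype.card K) (Fintype.card F) φ
            (Module.finrank K F - radDim σ a b) ε := by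
  have hp : (Fintype.card K : ℚ) ≠ 0 := by simp
  have hr : (Module.finrank K F - radDim σ a b) + radDim σ a b = Module.finrank K F :=
    Nat.sub_add_cancel (Submodule.finrank_le _)
  obtain ⟨ε, hε, h⟩ := exists_sign_levelCard_traceQuadForm hK σ a b hr
  have hq : ∀ r : ℕ, zeroCount (Fintype.card K) (Fintype.card F) r 0 =
      (Fintype.card F : ℚ) / Fintype.card K := by
    intro r
    rw [zeroCount, add_zero, pow_succ]
    field_simp
  refine ⟨ε, hε, ?_, fun φ => ?_⟩
  · rw [h, formZeros]
    split_ifs with he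
    · simp [quadProfile, he, zeroCount]
    · rw [← hq (Module.finrank K F - radDim σ a b)]
      simp [quadProfile, he, zeroCount]
  · rw [sum_perturbed σ a b hr (Ring.two_ne_zero hK), formContribution]
    congr 2
    simp only [h]
    refine (sum_quadProfile hK (Module.finrank K F - radDim σ a b) fun y =>
      φ (zeroCount (Fintype.card K) (Fintype.card F)
        (Module.finrank K F - radDim σ a b) (ε * y))).trans ?_
    simp only [mul_zero, hq]
    rcases hε with rfl | rfl <;> simp <;> split_ifs <;> ring

end Perturbation

/-! ### Equations for the joint distribution of radical dimension and sign. -/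

section RankDistribution

open Finset

variable {K F : Type*} [Field K] [Fintype K] [DecidableEq K] [Field F] [Fintype F] [DecidableEq F]
  [Algebra K F]

/-- The distribution of radical dimensions and signs in the family `traceQuadForm σ a b`, together
with the sums over zero counts of all affine perturbations. -/
theorem exists_rank_distribution (hK : ringChar K ≠ 2) {σ : F ≃ₐ[K] F}
    (hσ : ∀ x, σ x = x → ∃ c : K, algebraMap K F c = x) {p q : ℚ} {m : ℕ}
    (hp : p = Fintype.card K) (hq : q = Fintype.card F) (hm : m = Module.finrank K F) :
    ∃ N : ℕ → ℚ → ℚ,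
      (∑ d ∈ range 3, (N d 1 + N d (-1)) = q ^ 2 - 1) ∧
      (∑ d ∈ range 3, (N d 1 + N d (-1)) * (p ^ d - 1) = (q - 1) ^ 2) ∧
      (∑ d ∈ range 3, (N d 1 + N d (-1)) * ((p ^ d - 1) * (p ^ d - p)) =
        (q - 1) * (q - p) * (p - 1)) ∧
      (p * ∑ d ∈ range 3, (N d 1 * formZeros p q (m - d) 1 +
          N d (-1) * formZeros p q (m - d) (-1)) = p * q ^ 2 + (q - 1) * q ^ 2 - p * q) ∧
      (p * ∑ d ∈ range 3, (p ^ d - 1) * (N d 1 * formZeros p q (m - d) 1 +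
          N d (-1) * formZeros p q (m - d) (-1)) =
        (q - 1) * (p ^ 2 * q + (q - p) * q) - p * (q - 1) * q) ∧
      ∀ φ : ℚ → ℚ, ∑ a : F, ∑ b : F, ∑ c : F, ∑ h : K,
        φ (levelCard (fun x => traceQuadForm σ a b x + Algebra.trace K F (c * x) + h) 0) =
        φ q + (p - 1) * φ 0 + (q - 1) * p * φ (q / p) +
        ∑ d ∈ range 3, (N d 1 * formContribution p q φ (m - d) 1 +
          N d (-1) * formContribution p q φ (m - d) (-1)) := by
  classical
  have h2K : (2 : K) ≠ 0 := Ring.two_ne_zero hK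
  have h2 : (2 : F) ≠ 0 := by
    rw [← map_ofNat (algebraMap K F)]
    simpa using h2K
  choose ε hε hzero hsum using fun ab : F × F =>
    sum_perturbed_eq_formContribution hK σ ab.1 ab.2
  -- The zero form is set apart: its radical is all of `F`, and the bound `d ≤ 2` concerns nonzero
  -- `(a, b)`.
  let S : Finset (F × F) := univ.erase 0
  have hqm : q = p ^ m := by
    rw [hp, hq, hm, Module.card_eq_pow_finrank (K := K) (V := F)]
    push_cast; rfl
  have hle : ∀ ab ∈ S, radDim σ ab.1 ab.2 ∈ range 3 := by
    intro ab hab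
    rw [mem_range, Nat.lt_succ_iff]
    refine finrank_ker_tracePolar_le hσ h2 ?_
    by_contra! h
    exact ne_of_mem_erase hab (Prod.ext h.1 h.2)
  let N : ℕ → ℚ → ℚ := fun d e => #{ab ∈ S | radDim σ ab.1 ab.2 = d ∧ ε ab = e}
  have hfib : ∀ g : ℕ → ℚ → ℚ, ∑ ab ∈ S, g (radDim σ ab.1 ab.2) (ε ab) =
      ∑ d ∈ range 3, (N d 1 * g d 1 + N d (-1) * g d (-1)) := by
    intro g
    have hN : ∀ d e, N d e * g d e =
        ∑ ab ∈ S, if radDim σ ab.1 ab.2 = d ∧ ε ab = e then g d e else 0 := by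
      intro d e
      rw [← sum_filter, sum_const, nsmul_eq_mul]
    simp only [hN, ← sum_add_distrib]
    rw [sum_comm]
    refine sum_congr rfl fun ab hab => ?_
    rw [sum_eq_single_of_mem _ (hle ab hab)]
    · rcases hε ab with h | h <;> simp [h] <;> norm_num
    · intro d _ hd
      simp [hd.symm]
  have hsplit : ∀ g : F → F → ℚ, ∑ a : F, ∑ b : F, g a b = g 0 0 + ∑ ab ∈ S, g ab.1 ab.2 := by
    intro g
    rw [← Fintype.sum_prod_type', ← add_sum_erase univ _ (mem_univ (0 : F × F))]
    rfl
  have hrad0 : radDim σ 0 0 = m := (finrank_ker_tracePolar_zero σ).trans hm.symm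
  have hZ : ∀ ab : F × F, levelCard (traceQuadForm σ ab.1 ab.2) 0 =
      formZeros p q (m - radDim σ ab.1 ab.2) (ε ab) := by
    intro ab; rw [hzero, hp, hq, hm]
  have hZ0 : levelCard (traceQuadForm σ 0 0) (0 : K) = q := by
    simp [levelCard, traceQuadForm_apply, hq]
  refine ⟨N, ?_, ?_, ?_, ?_, ?_, fun φ => ?_⟩
  · have h := hfib fun _ _ => 1
    simp only [mul_one] at h
    rw [← h, sum_const, nsmul_eq_mul, mul_one, card_erase_of_mem (mem_univ _), card_univ,
      Fintype.card_prod, Nat.cast_sub (Nat.mul_pos Fintype.card_pos Fintype.card_pos), hq]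
    push_cast; ring
  · have h := sum_pow_radDim σ h2
    rw [hsplit, hrad0, ← hp, ← hq, ← hqm, hfib fun d _ => p ^ d - 1] at h
    simp only [add_mul]
    linear_combination h
  · have h := sum_radDim_pairs hσ h2
    rw [hsplit, hrad0, ← hp, ← hq, ← hqm, hfib fun d _ => (p ^ d - 1) * (p ^ d - p)] at h
    simp only [add_mul]
    linear_combination h
  · have h := sum_levelCard_zero σ
    rw [hsplit, ← hp, ← hq, hZ0, sum_congr rfl fun ab _ => hZ ab,
      hfib fun d e => formZeros p q (m - d) e] at h
    linear_combination h
  · have h := sum_pow_radDim_mul_levelCard hσ h2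
    rw [hsplit, ← hp, ← hq, hrad0, hZ0, ← hqm, sum_congr rfl fun ab _ =>
      congrArg (fun z => (p ^ radDim σ ab.1 ab.2 - 1) * z) (hZ ab),
      hfib fun d e => (p ^ d - 1) * formZeros p q (m - d) e] at h
    simp only [mul_add, mul_left_comm (_ - _) (N _ _)]
    linear_combination h
  · rw [hsplit, sum_congr rfl fun ab _ => hsum ab φ, ← hp, ← hq, ← hm,
      hfib fun d e => formContribution p q φ (m - d) e]
    congr 1
    -- The zero form has rank `0`: only `c = 0` is in the range, and then the word is constant, with
    -- `q` zeros for one constant and none for the other `p - 1`.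
    rw [sum_perturbed σ 0 0 (r := 0) (by rw [hrad0, hm, zero_add]) h2K, ← hp, ← hq,
      ← add_sum_erase univ _ (mem_univ (0 : K)), hZ0]
    rw [sum_congr rfl (g := fun _ => φ 0), sum_const, nsmul_eq_mul,
      card_erase_of_mem (mem_univ _), card_univ, Nat.cast_sub Fintype.card_pos, ← hp]
    · push_cast; ring
    · intro t ht
      congr 1
      simp [levelCard, traceQuadForm_apply, (ne_of_mem_erase ht).symm]

end RankDistribution

/-! ### Solving the moment equations and matching the tables. -/

section Tables

open Finset

/-- This is the functional `ψ ↦ ∑ multiplicity * ψ(weight)` at an indicator, and it treats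
coinciding weights correctly. -/
lemma tableMultiplicity_eq_sum (T : List (ℚ × ℚ)) (w : ℚ) :
    tableMultiplicity T w = (T.map fun r => r.2 * if r.1 = w then 1 else 0).sum := by
  induction T with
  | nil => simp [tableMultiplicity]
  | cons r T ih =>
    rw [tableMultiplicity] at ih ⊢
    by_cases h : r.1 = w
    · simp [h, ih]
    · simp [h, ih]

/-- In terms of `u = p ^ j` all entries are rational expressions in `p` and `u`, free of truncated
subtraction and within reach of `ring`. -/
lemma oddTable_eq (p : ℚ) (j : ℕ) (u : ℚ) (hu : u = p ^ j) :
    oddTable p (2 * j + 3) =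
  [ (0, 1),
    (p ^ 2 * u ^ 2 * (p - 1),
      p * (2 * (p ^ 5 * u ^ 4) - 2 * (p ^ 4 * u ^ 4) + p ^ 3 * u ^ 4 - p ^ 2 * u ^ 4
        + p ^ 2 * u ^ 2 - p * u ^ 2 + u ^ 2 + 1) * (p ^ 3 * u ^ 2 - 1)),
    (p * u * (p ^ 2 * u - p * u - p + 1),
      1 / 2 * (p ^ 3 * u ^ 3) * (p ^ 3 * u ^ 2 - 1) * (p * u + 1)),
    (p * u * (p ^ 2 * u - p * u + p - 1),
      1 / 2 * (p ^ 3 * u ^ 3) * (p ^ 3 * u ^ 2 - 1) * (p * u - 1)),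
    (p * u * (p ^ 2 * u - p * u + 1),
      p ^ 3 * u ^ 2 * (p ^ 3 * u ^ 2 - 1) * (p ^ 5 * u ^ 2 - p ^ 4 * u ^ 2 - p * u ^ 2
        + p ^ 2 * u - u + p ^ 2) / (2 * (p + 1))),
    (p * u * (p ^ 2 * u - p * u - 1),
      p ^ 3 * u ^ 2 * (p ^ 3 * u ^ 2 - 1) * (p ^ 5 * u ^ 2 - p ^ 4 * u ^ 2 - p * u ^ 2
        - p ^ 2 * u + u + p ^ 2) / (2 * (p + 1))),
    (p ^ 2 * u * (p * u - u + 1),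
      1 / 2 * (p * u ^ 2) * (p ^ 3 * u ^ 2 - 1) * (p ^ 2 * u ^ 2 - 1) / (p + 1)),
    (p ^ 2 * u * (p * u - u - 1),
      1 / 2 * (p * u ^ 2) * (p ^ 3 * u ^ 2 - 1) * (p ^ 2 * u ^ 2 - 1) / (p + 1)),
    (p ^ 3 * u ^ 2, p - 1) ] := by
  have e0 : p ^ (2 * j + 3 - 1) = p ^ 2 * u ^ 2 := by
    rw [show 2 * j + 3 - 1 = 2 * j + 2 by omega, hu]; ring
  have e1 : p ^ (2 * (2 * j + 3) - 1) = p ^ 5 * u ^ 4 := by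
    rw [show 2 * (2 * j + 3) - 1 = 4 * j + 5 by omega, hu]; ring
  have e2 : p ^ (2 * (2 * j + 3) - 2) = p ^ 4 * u ^ 4 := by
    rw [show 2 * (2 * j + 3) - 2 = 4 * j + 4 by omega, hu]; ring
  have e3 : p ^ (2 * (2 * j + 3) - 3) = p ^ 3 * u ^ 4 := by
    rw [show 2 * (2 * j + 3) - 3 = 4 * j + 3 by omega, hu]; ring
  have e4 : p ^ (2 * (2 * j + 3) - 4) = p ^ 2 * u ^ 4 := by
    rw [show 2 * (2 * j + 3) - 4 = 4 * j + 2 by omega, hu]; ring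
  have e5 : p ^ (2 * j + 3 - 2) = p * u ^ 2 := by
    rw [show 2 * j + 3 - 2 = 2 * j + 1 by omega, hu]; ring
  have e6 : p ^ (2 * j + 3 - 3) = u ^ 2 := by
    rw [show 2 * j + 3 - 3 = 2 * j by omega, hu]; ring
  have e7 : p ^ ((2 * j + 3 - 1) / 2) = p * u := by
    rw [show (2 * j + 3 - 1) / 2 = j + 1 by omega, hu]; ring
  have e8 : p ^ ((2 * j + 3 + 1) / 2) = p ^ 2 * u := by
    rw [show (2 * j + 3 + 1) / 2 = j + 2 by omega, hu]; ring
  have e9 : p ^ ((3 * (2 * j + 3) - 3) / 2) = p ^ 3 * u ^ 3 := by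
    rw [show (3 * (2 * j + 3) - 3) / 2 = 3 * j + 3 by omega, hu]; ring
  have e10 : p ^ (2 * j + 3 + 2) = p ^ 5 * u ^ 2 := by
    rw [show 2 * j + 3 + 2 = 2 * j + 5 by omega, hu]; ring
  have e11 : p ^ (2 * j + 3 + 1) = p ^ 4 * u ^ 2 := by
    rw [show 2 * j + 3 + 1 = 2 * j + 4 by omega, hu]; ring
  have e12 : p ^ ((2 * j + 3 - 3) / 2) = u := by
    rw [show (2 * j + 3 - 3) / 2 = j by omega, hu]
  have e13 : p ^ (2 * j + 3) = p ^ 3 * u ^ 2 := by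
    rw [hu]; ring
  rw [oddTable, e0, e1, e2, e3, e4, e5, e6, e7, e8, e9, e10, e11, e12, e13]

lemma evenTable_eq (p : ℚ) (j : ℕ) (u : ℚ) (hu : u = p ^ j) :
    evenTable p (2 * j + 4) =
  [ (0, 1),
    (p ^ 3 * u ^ 2 * (p - 1),
      p * (p ^ 7 * u ^ 4 - p ^ 6 * u ^ 4 + 2 * (p ^ 5 * u ^ 4) - p ^ 2 * u ^ 2 + 1)
        * (p ^ 4 * u ^ 2 - 1)),
    (p * u * (p ^ 3 * u - p ^ 2 * u - p + 1),
      p ^ 6 * u ^ 2 * (p ^ 4 * u ^ 2 - 1) * (p ^ 4 * u ^ 2 - p ^ 3 * u ^ 2 - p ^ 2 * u ^ 2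
        + p ^ 2 * u - p * u + 1) / (2 * (p ^ 2 - 1))),
    (p ^ 2 * u * (p ^ 2 * u - p * u - p + 1),
      1 / 2 * (p ^ 2 * u ^ 2) * (p ^ 4 * u ^ 2 - 1) * (p ^ 2 * u - 1) * (p * u + 1)
        / (p ^ 2 - 1)),
    (p * u * (p ^ 3 * u - p ^ 2 * u + p - 1),
      p ^ 6 * u ^ 2 * (p ^ 4 * u ^ 2 - 1) * (p ^ 4 * u ^ 2 - p ^ 3 * u ^ 2 - p ^ 2 * u ^ 2
        - p ^ 2 * u + p * u + 1) / (2 * (p ^ 2 - 1))),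
    (p ^ 2 * u * (p ^ 2 * u - p * u + p - 1),
      1 / 2 * (p ^ 2 * u ^ 2) * (p ^ 4 * u ^ 2 - 1) * (p ^ 2 * u + 1) * (p * u - 1)
        / (p ^ 2 - 1)),
    (p * u * (p ^ 3 * u - p ^ 2 * u + 1),
      p ^ 6 * u ^ 2 * (p ^ 4 * u ^ 2 - 1) * (p ^ 4 * u ^ 2 - p ^ 3 * u ^ 2 - p ^ 2 * u ^ 2
        + p ^ 2 * u - p * u + 1) / (2 * (p + 1))),
    (p ^ 2 * u * (p ^ 2 * u - p * u + 1),
      p ^ 2 * u ^ 2 * (p ^ 4 * u ^ 2 - 1) * (p ^ 6 * u ^ 2 - p ^ 4 * u ^ 2 + p ^ 3 * u ^ 2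
        + p ^ 2 * u - p * u - 1) / (2 * (p + 1))),
    (p * u * (p ^ 3 * u - p ^ 2 * u - 1),
      p ^ 6 * u ^ 2 * (p ^ 4 * u ^ 2 - 1) * (p ^ 4 * u ^ 2 - p ^ 3 * u ^ 2 - p ^ 2 * u ^ 2
        - p ^ 2 * u + p * u + 1) / (2 * (p + 1))),
    (p ^ 2 * u * (p ^ 2 * u - p * u - 1),
      p ^ 2 * u ^ 2 * (p ^ 4 * u ^ 2 - 1) * (p ^ 6 * u ^ 2 - p ^ 4 * u ^ 2 + p ^ 3 * u ^ 2
        - p ^ 2 * u + p * u - 1) / (2 * (p + 1))),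
    (p ^ 4 * u ^ 2, p - 1) ] := by
  have e0 : p ^ (2 * j + 4 - 1) = p ^ 3 * u ^ 2 := by
    rw [show 2 * j + 4 - 1 = 2 * j + 3 by omega, hu]; ring
  have e1 : p ^ (2 * (2 * j + 4) - 1) = p ^ 7 * u ^ 4 := by
    rw [show 2 * (2 * j + 4) - 1 = 4 * j + 7 by omega, hu]; ring
  have e2 : p ^ (2 * (2 * j + 4) - 2) = p ^ 6 * u ^ 4 := by
    rw [show 2 * (2 * j + 4) - 2 = 4 * j + 6 by omega, hu]; ring
  have e3 : p ^ (2 * (2 * j + 4) - 3) = p ^ 5 * u ^ 4 := by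
    rw [show 2 * (2 * j + 4) - 3 = 4 * j + 5 by omega, hu]; ring
  have e4 : p ^ (2 * j + 4 - 2) = p ^ 2 * u ^ 2 := by
    rw [show 2 * j + 4 - 2 = 2 * j + 2 by omega, hu]; ring
  have e5 : p ^ ((2 * j + 4 - 2) / 2) = p * u := by
    rw [show (2 * j + 4 - 2) / 2 = j + 1 by omega, hu]; ring
  have e6 : p ^ ((2 * j + 4 + 2) / 2) = p ^ 3 * u := by
    rw [show (2 * j + 4 + 2) / 2 = j + 3 by omega, hu]; ring
  have e7 : p ^ ((2 * j + 4) / 2) = p ^ 2 * u := by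
    rw [show (2 * j + 4) / 2 = j + 2 by omega, hu]; ring
  have e8 : p ^ (2 * j + 4 + 2) = p ^ 6 * u ^ 2 := by
    rw [show 2 * j + 4 + 2 = 2 * j + 6 by omega, hu]; ring
  have e9 : p ^ (2 * j + 4) = p ^ 4 * u ^ 2 := by
    rw [hu]; ring
  rw [evenTable, e0, e1, e2, e3, e4, e5, e6, e7, e8, e9]

/-- The constraints on the distribution of radical dimensions and signs. -/
structure RankDistribution (p q : ℚ) (m : ℕ) (N : ℕ → ℚ → ℚ) : Prop where
  total : ∑ d ∈ range 3, (N d 1 + N d (-1)) = q ^ 2 - 1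
  radical : ∑ d ∈ range 3, (N d 1 + N d (-1)) * (p ^ d - 1) = (q - 1) ^ 2
  radicalPairs : ∑ d ∈ range 3, (N d 1 + N d (-1)) * ((p ^ d - 1) * (p ^ d - p)) =
    (q - 1) * (q - p) * (p - 1)
  zeros : p * ∑ d ∈ range 3, (N d 1 * formZeros p q (m - d) 1 +
    N d (-1) * formZeros p q (m - d) (-1)) = p * q ^ 2 + (q - 1) * q ^ 2 - p * q
  radicalZeros : p * ∑ d ∈ range 3, (p ^ d - 1) * (N d 1 * formZeros p q (m - d) 1 +
    N d (-1) * formZeros p q (m - d) (-1)) =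
    (q - 1) * (p ^ 2 * q + (q - p) * q) - p * (q - 1) * q

/-- Only `d = 1` gives even rank, so only there do the two signs have to be separated; for `d = 0,
2` the totals suffice. For general `ψ` the claim is a comparison of coefficients. -/
lemma RankDistribution.sum_odd {p q : ℚ} (hp : 1 < p) {j : ℕ} (hq : q = p ^ (2 * j + 3))
    {N : ℕ → ℚ → ℚ} (hN : RankDistribution p q (2 * j + 3) N) (ψ : ℚ → ℚ) :
    ψ 0 + (p - 1) * ψ q + (q - 1) * p * ψ (q - q / p) +
        ∑ d ∈ range 3, (N d 1 * formContribution p q (fun z => ψ (q - z)) (2 * j + 3 - d) 1 +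
          N d (-1) * formContribution p q (fun z => ψ (q - z)) (2 * j + 3 - d) (-1)) =
      ((oddTable p (2 * j + 3)).map fun r => r.2 * ψ r.1).sum := by
  obtain ⟨u, hu⟩ : ∃ u, u = p ^ j := ⟨_, rfl⟩
  have hu0 : u ≠ 0 := by rw [hu]; positivity
  have hp0 : p ≠ 0 := by positivity
  have hp1 : p - 1 ≠ 0 := by linarith
  have hp2 : p + 1 ≠ 0 := by linarith
  have hqu : q = p ^ 3 * u ^ 2 := by rw [hq, hu]; ring
  rw [oddTable_eq p j u hu]
  have d1 : 2 * j + 3 - 1 = 2 * j + 2 := by omega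
  have d2 : 2 * j + 3 - 2 = 2 * j + 1 := by omega
  have h0 : ¬ Even (2 * j + 3) := by simp [parity_simps]
  have h1 : Even (2 * j + 2) := by simp [parity_simps]
  have h2 : ¬ Even (2 * j + 1) := by simp [parity_simps]
  have z0 : ∀ s, zeroCount p q (2 * j + 3) s = p ^ 2 * u ^ 2 + s * (p * u) := by
    intro s
    rw [zeroCount, show (2 * j + 3) / 2 = j + 1 by omega, pow_succ p (j + 1), pow_succ, ← hu, hqu]
    field_simp
  have z1 : ∀ s, zeroCount p q (2 * j + 2) s = p ^ 2 * u ^ 2 + s * (p * u) := by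
    intro s
    rw [zeroCount, show (2 * j + 2) / 2 = j + 1 by omega, pow_succ p (j + 1), pow_succ, ← hu, hqu]
    field_simp
  have z2 : ∀ s, zeroCount p q (2 * j + 1) s = p ^ 2 * u ^ 2 + s * (p ^ 2 * u) := by
    intro s
    rw [zeroCount, show (2 * j + 1) / 2 = j by omega, pow_succ, ← hu, hqu]
    field_simp
  have hqp : q / p = p ^ 2 * u ^ 2 := by rw [hqu]; field_simp
  -- The single unknown sign difference already follows from `zeros`, so `radicalZeros` is dropped.
  obtain ⟨E0, E1, E2, E3, -⟩ := hN
  simp only [sum_range_succ, range_zero, sum_empty, zero_add, Nat.sub_zero, d1, d2, formZeros,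
    h0, h1, h2, if_true, if_false, z1, hqp, pow_zero, pow_one, sub_self, zero_mul, mul_zero]
    at E0 E1 E2 E3
  have n2 : N 2 1 + N 2 (-1) = (q - 1) * (p ^ 2 * u ^ 2 - 1) / (p ^ 2 - 1) := by
    have : p ^ 2 - 1 ≠ 0 := by
      rw [show p ^ 2 - 1 = (p - 1) * (p + 1) by ring]; exact mul_ne_zero hp1 hp2
    rw [eq_div_iff this]
    apply mul_left_cancel₀ (mul_ne_zero hp0 hp1)
    rw [hqu] at E2 ⊢
    linear_combination E2
  have n1 : N 1 1 + N 1 (-1) = (q - 1) * (p ^ 2 * u ^ 2) := by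
    apply mul_left_cancel₀ hp1
    rw [eq_div_iff] at n2
    · rw [hqu] at n2 E1 ⊢
      linear_combination E1 - n2
    · rw [show p ^ 2 - 1 = (p - 1) * (p + 1) by ring]; exact mul_ne_zero hp1 hp2
  have s1 : N 1 1 - N 1 (-1) = (q - 1) * (p * u) := by
    apply mul_left_cancel₀ (mul_ne_zero hp1 (mul_ne_zero (pow_ne_zero 2 hp0) hu0))
    rw [hqu] at E0 E3 ⊢
    linear_combination E3 - p ^ 3 * u ^ 2 * E0
  have a1 : N 1 1 = (q - 1) * (p ^ 2 * u ^ 2 + p * u) / 2 := by linarith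
  have a2 : N 1 (-1) = (q - 1) * (p ^ 2 * u ^ 2 - p * u) / 2 := by linarith
  -- Here and in `n2'` the count with sign `-1` stays undetermined; it cancels at the end.
  have n0 : N 0 1 = q ^ 2 - 1 - (q - 1) * (p ^ 2 * u ^ 2) -
      (q - 1) * (p ^ 2 * u ^ 2 - 1) / (p ^ 2 - 1) - N 0 (-1) := by
    rw [← n1, ← n2]; linear_combination E0
  have n2' : N 2 1 = (q - 1) * (p ^ 2 * u ^ 2 - 1) / (p ^ 2 - 1) - N 2 (-1) := by
    rw [← n2]; ring
  have pw0 : p ^ (2 * j + 3) = p ^ 3 * u ^ 2 := by rw [hu]; ring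
  have pw1 : p ^ (2 * j + 2) = p ^ 2 * u ^ 2 := by rw [hu]; ring
  have pw2 : p ^ (2 * j + 1) = p * u ^ 2 := by rw [hu]; ring
  simp only [sum_range_succ, range_zero, sum_empty, zero_add, Nat.sub_zero, d1, d2,
    formContribution, h0, h1, h2, if_true, if_false, z0, z1, z2, hqp, pw0, pw1, pw2,
    List.map_cons, List.map_nil, List.sum_cons, List.sum_nil]
  rw [a1, a2, n0, n2', hqu]
  have w1 : p ^ 3 * u ^ 2 - p ^ 2 * u ^ 2 = p ^ 2 * u ^ 2 * (p - 1) := by ring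
  have w2 : p ^ 3 * u ^ 2 - (p ^ 2 * u ^ 2 + 1 * (p - 1) * (p * u)) =
    p * u * (p ^ 2 * u - p * u - p + 1) := by ring
  have w3 : p ^ 3 * u ^ 2 - (p ^ 2 * u ^ 2 + -1 * (p - 1) * (p * u)) =
    p * u * (p ^ 2 * u - p * u + p - 1) := by ring
  have w4 : p ^ 3 * u ^ 2 - (p ^ 2 * u ^ 2 + -1 * (p * u)) =
    p * u * (p ^ 2 * u - p * u + 1) := by ring
  have w5 : p ^ 3 * u ^ 2 - (p ^ 2 * u ^ 2 + 1 * (p * u)) =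
    p * u * (p ^ 2 * u - p * u - 1) := by ring
  have w6 : p ^ 3 * u ^ 2 - (p ^ 2 * u ^ 2 + -1 * (p ^ 2 * u)) =
    p ^ 2 * u * (p * u - u + 1) := by ring
  have w7 : p ^ 3 * u ^ 2 - (p ^ 2 * u ^ 2 + 1 * (p ^ 2 * u)) =
    p ^ 2 * u * (p * u - u - 1) := by ring
  simp only [neg_neg, w1, w2, w3, w4, w5, w6, w7]
  -- With the values of `ψ` abstracted, a rational identity in `p`, `u` and free variables is left.
  generalize ψ (p ^ 2 * u ^ 2 * (p - 1)) = x1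
  generalize ψ (p * u * (p ^ 2 * u - p * u - p + 1)) = x2
  generalize ψ (p * u * (p ^ 2 * u - p * u + p - 1)) = x3
  generalize ψ (p * u * (p ^ 2 * u - p * u + 1)) = x4
  generalize ψ (p * u * (p ^ 2 * u - p * u - 1)) = x5
  generalize ψ (p ^ 2 * u * (p * u - u + 1)) = x6
  generalize ψ (p ^ 2 * u * (p * u - u - 1)) = x7
  generalize ψ (p ^ 3 * u ^ 2) = x8
  rw [show p ^ 2 - 1 = (p - 1) * (p + 1) by ring]
  field_simp
  ring

/-- Now `d = 0` and `d = 2` give even rank, so two sign differences are needed, while for `d = 1`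
the total suffices. -/
lemma RankDistribution.sum_even {p q : ℚ} (hp : 1 < p) {j : ℕ} (hq : q = p ^ (2 * j + 4))
    {N : ℕ → ℚ → ℚ} (hN : RankDistribution p q (2 * j + 4) N) (ψ : ℚ → ℚ) :
    ψ 0 + (p - 1) * ψ q + (q - 1) * p * ψ (q - q / p) +
        ∑ d ∈ range 3, (N d 1 * formContribution p q (fun z => ψ (q - z)) (2 * j + 4 - d) 1 +
          N d (-1) * formContribution p q (fun z => ψ (q - z)) (2 * j + 4 - d) (-1)) =
      ((evenTable p (2 * j + 4)).map fun r => r.2 * ψ r.1).sum := by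
  obtain ⟨u, hu⟩ : ∃ u, u = p ^ j := ⟨_, rfl⟩
  have hu0 : u ≠ 0 := by rw [hu]; positivity
  have hp0 : p ≠ 0 := by positivity
  have hp1 : p - 1 ≠ 0 := by linarith
  have hp2 : p + 1 ≠ 0 := by linarith
  have hp3 : p ^ 2 - 1 ≠ 0 := by
    rw [show p ^ 2 - 1 = (p - 1) * (p + 1) by ring]; exact mul_ne_zero hp1 hp2
  have hqu : q = p ^ 4 * u ^ 2 := by rw [hq, hu]; ring
  rw [evenTable_eq p j u hu]
  have d1 : 2 * j + 4 - 1 = 2 * j + 3 := by omega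
  have d2 : 2 * j + 4 - 2 = 2 * j + 2 := by omega
  have h0 : Even (2 * j + 4) := ⟨j + 2, by ring⟩
  have h1 : ¬ Even (2 * j + 3) := by simp [parity_simps]
  have h2 : Even (2 * j + 2) := ⟨j + 1, by ring⟩
  have z0 : ∀ s, zeroCount p q (2 * j + 4) s = p ^ 3 * u ^ 2 + s * (p * u) := by
    intro s
    rw [zeroCount, show (2 * j + 4) / 2 = j + 2 by omega, pow_succ p (j + 2), pow_add, ← hu, hqu]
    field_simp
  have z1 : ∀ s, zeroCount p q (2 * j + 3) s = p ^ 3 * u ^ 2 + s * (p ^ 2 * u) := by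
    intro s
    rw [zeroCount, show (2 * j + 3) / 2 = j + 1 by omega, pow_succ p (j + 1), pow_succ, ← hu, hqu]
    field_simp
  have z2 : ∀ s, zeroCount p q (2 * j + 2) s = p ^ 3 * u ^ 2 + s * (p ^ 2 * u) := by
    intro s
    rw [zeroCount, show (2 * j + 2) / 2 = j + 1 by omega, pow_succ p (j + 1), pow_succ, ← hu, hqu]
    field_simp
  have hqp : q / p = p ^ 3 * u ^ 2 := by rw [hqu]; field_simp
  obtain ⟨E0, E1, E2, E3, E4⟩ := hN
  simp only [sum_range_succ, range_zero, sum_empty, zero_add, Nat.sub_zero, d1, d2, formZeros,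
    h0, h1, h2, if_true, if_false, z0, z2, hqp, pow_zero, pow_one, sub_self, zero_mul, mul_zero]
    at E0 E1 E2 E3 E4
  have n2 : N 2 1 + N 2 (-1) = (q - 1) * (p ^ 3 * u ^ 2 - 1) / (p ^ 2 - 1) := by
    rw [eq_div_iff hp3]
    apply mul_left_cancel₀ (mul_ne_zero hp0 hp1)
    rw [hqu] at E2 ⊢
    linear_combination E2
  have n1 : N 1 1 + N 1 (-1) = (q - 1) * (p ^ 3 * u ^ 2) := by
    apply mul_left_cancel₀ hp1
    rw [eq_div_iff hp3, hqu] at n2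
    rw [hqu] at E1 ⊢
    linear_combination E1 - n2
  -- The weight `p ^ d - 1` kills `d = 0` in `radicalZeros`, which isolates this difference; `zeros`
  -- then gives the one for `d = 0`.
  have s2 : N 2 1 - N 2 (-1) = (q - 1) * (p * u) / (p + 1) := by
    rw [eq_div_iff hp2]
    apply mul_left_cancel₀ (mul_ne_zero (mul_ne_zero hp1 hp1) (mul_ne_zero (pow_ne_zero 3 hp0) hu0))
    rw [eq_div_iff hp3, hqu] at n2
    rw [hqu] at E4 n1 ⊢
    linear_combination E4 - p ^ 4 * u ^ 2 * n2 - (p - 1) * p ^ 4 * u ^ 2 * n1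
  have s0 : N 0 1 - N 0 (-1) = (q - 1) * (p ^ 2 * u) - p * ((q - 1) * (p * u) / (p + 1)) := by
    rw [← s2]
    apply mul_left_cancel₀ (mul_ne_zero hp1 (mul_ne_zero (pow_ne_zero 2 hp0) hu0))
    rw [hqu] at E0 E3 ⊢
    linear_combination E3 - p ^ 4 * u ^ 2 * E0
  have n0 : N 0 1 + N 0 (-1) = q ^ 2 - 1 - (q - 1) * (p ^ 3 * u ^ 2) -
      (q - 1) * (p ^ 3 * u ^ 2 - 1) / (p ^ 2 - 1) := by
    rw [← n1, ← n2]; linear_combination E0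
  have a1 : N 0 1 = (q ^ 2 - 1 - (q - 1) * (p ^ 3 * u ^ 2) -
      (q - 1) * (p ^ 3 * u ^ 2 - 1) / (p ^ 2 - 1) +
      ((q - 1) * (p ^ 2 * u) - p * ((q - 1) * (p * u) / (p + 1)))) / 2 := by linarith
  have a2 : N 0 (-1) = (q ^ 2 - 1 - (q - 1) * (p ^ 3 * u ^ 2) -
      (q - 1) * (p ^ 3 * u ^ 2 - 1) / (p ^ 2 - 1) -
      ((q - 1) * (p ^ 2 * u) - p * ((q - 1) * (p * u) / (p + 1)))) / 2 := by linarith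
  have a3 : N 2 1 = ((q - 1) * (p ^ 3 * u ^ 2 - 1) / (p ^ 2 - 1) +
      (q - 1) * (p * u) / (p + 1)) / 2 := by linarith
  have a4 : N 2 (-1) = ((q - 1) * (p ^ 3 * u ^ 2 - 1) / (p ^ 2 - 1) -
      (q - 1) * (p * u) / (p + 1)) / 2 := by linarith
  have n1' : N 1 1 = (q - 1) * (p ^ 3 * u ^ 2) - N 1 (-1) := by rw [← n1]; ring
  have pw0 : p ^ (2 * j + 4) = p ^ 4 * u ^ 2 := by rw [hu]; ring
  have pw1 : p ^ (2 * j + 3) = p ^ 3 * u ^ 2 := by rw [hu]; ring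
  have pw2 : p ^ (2 * j + 2) = p ^ 2 * u ^ 2 := by rw [hu]; ring
  simp only [sum_range_succ, range_zero, sum_empty, zero_add, Nat.sub_zero, d1, d2,
    formContribution, h0, h1, h2, if_true, if_false, z0, z1, z2, hqp, pw0, pw1, pw2,
    List.map_cons, List.map_nil, List.sum_cons, List.sum_nil]
  rw [a1, a2, a3, a4, n1', hqu]
  have w1 : p ^ 4 * u ^ 2 - p ^ 3 * u ^ 2 = p ^ 3 * u ^ 2 * (p - 1) := by ring
  have w2 : p ^ 4 * u ^ 2 - (p ^ 3 * u ^ 2 + 1 * (p - 1) * (p * u)) =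
    p * u * (p ^ 3 * u - p ^ 2 * u - p + 1) := by ring
  have w3 : p ^ 4 * u ^ 2 - (p ^ 3 * u ^ 2 + -1 * (p - 1) * (p * u)) =
    p * u * (p ^ 3 * u - p ^ 2 * u + p - 1) := by ring
  have w4 : p ^ 4 * u ^ 2 - (p ^ 3 * u ^ 2 + -1 * (p * u)) =
    p * u * (p ^ 3 * u - p ^ 2 * u + 1) := by ring
  have w5 : p ^ 4 * u ^ 2 - (p ^ 3 * u ^ 2 + 1 * (p * u)) =
    p * u * (p ^ 3 * u - p ^ 2 * u - 1) := by ring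
  have w6 : p ^ 4 * u ^ 2 - (p ^ 3 * u ^ 2 + 1 * (p - 1) * (p ^ 2 * u)) =
    p ^ 2 * u * (p ^ 2 * u - p * u - p + 1) := by ring
  have w7 : p ^ 4 * u ^ 2 - (p ^ 3 * u ^ 2 + -1 * (p - 1) * (p ^ 2 * u)) =
    p ^ 2 * u * (p ^ 2 * u - p * u + p - 1) := by ring
  have w8 : p ^ 4 * u ^ 2 - (p ^ 3 * u ^ 2 + -1 * (p ^ 2 * u)) =
    p ^ 2 * u * (p ^ 2 * u - p * u + 1) := by ring
  have w9 : p ^ 4 * u ^ 2 - (p ^ 3 * u ^ 2 + 1 * (p ^ 2 * u)) =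
    p ^ 2 * u * (p ^ 2 * u - p * u - 1) := by ring
  simp only [neg_neg, w1, w2, w3, w4, w5, w6, w7, w8, w9]
  generalize ψ (p ^ 3 * u ^ 2 * (p - 1)) = x1
  generalize ψ (p * u * (p ^ 3 * u - p ^ 2 * u - p + 1)) = x2
  generalize ψ (p * u * (p ^ 3 * u - p ^ 2 * u + p - 1)) = x3
  generalize ψ (p * u * (p ^ 3 * u - p ^ 2 * u + 1)) = x4
  generalize ψ (p * u * (p ^ 3 * u - p ^ 2 * u - 1)) = x5
  generalize ψ (p ^ 2 * u * (p ^ 2 * u - p * u - p + 1)) = x6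
  generalize ψ (p ^ 2 * u * (p ^ 2 * u - p * u + p - 1)) = x7
  generalize ψ (p ^ 2 * u * (p ^ 2 * u - p * u + 1)) = x8
  generalize ψ (p ^ 2 * u * (p ^ 2 * u - p * u - 1)) = x9
  generalize ψ (p ^ 4 * u ^ 2) = x10
  rw [show p ^ 2 - 1 = (p - 1) * (p + 1) by ring]
  field_simp
  ring

end Tables

/-! ### Counting the distinct nonzero weights. -/

section NumberOfWeights

open Finset

lemma tableMultiplicity_pos_iff {T : List (ℚ × ℚ)} (hpos : ∀ r ∈ T, 0 < r.2) (w : ℚ) :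
    0 < tableMultiplicity T w ↔ w ∈ T.map Prod.fst := by
  induction T with
  | nil => simp [tableMultiplicity]
  | cons r T ih =>
    have h0 : 0 ≤ tableMultiplicity T w := by
      refine List.sum_nonneg fun x hx => ?_
      obtain ⟨y, hy, rfl⟩ := List.mem_map.1 hx
      exact (hpos y (List.mem_cons_of_mem _ (List.mem_filter.1 hy).1)).le
    have ih' := ih fun r hr => hpos r (List.mem_cons_of_mem _ hr)
    have hr := hpos r List.mem_cons_self
    have hcons : tableMultiplicity (r :: T) w =
        (if r.1 = w then r.2 else 0) + tableMultiplicity T w := by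
      unfold tableMultiplicity
      by_cases h : r.1 = w <;> simp [h]
    rw [hcons, List.map_cons, List.mem_cons, ← ih']
    split_ifs with h
    · simp only [h, true_or, iff_true]; linarith
    · simp [Ne.symm h]

/-- With positive multiplicities, the weights that occur are the natural numbers among the table
entries. The list `l` enumerates the nonzero entries in increasing order; integrality makes each of
them a natural number. -/
lemma numNonzeroWeights_eq_length {K ι : Type*} [Field K] [DecidableEq K] [Fintype ι]
    {C : Submodule K (ι → K)} {T : List (ℚ × ℚ)}
    (hC : ∀ w : ℕ, (weightCount C w : ℚ) = tableMultiplicity T w)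
    (hpos : ∀ r ∈ T, 0 < r.2) {l : List ℚ} (hl : (0 :: l).Pairwise (· < ·))
    (hmem : ∀ x, x ∈ T.map Prod.fst ↔ x = 0 ∨ x ∈ l)
    (hint : ∀ x ∈ l, ∃ z : ℤ, (z : ℚ) = x) :
    numNonzeroWeights C = l.length := by
  rw [List.pairwise_cons] at hl
  rw [← List.toFinset_card_of_nodup (hl.2.imp ne_of_lt), ← Set.ncard_coe_finset, numNonzeroWeights,
    ← Set.ncard_image_of_injective _ (Nat.cast_injective (R := ℚ))]
  congr 1
  ext x
  simp only [Set.mem_image, Set.mem_ofPred_eq, List.coe_toFinset]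
  have key : ∀ w : ℕ, 0 < weightCount C w ↔ (w : ℚ) ∈ T.map Prod.fst := by
    intro w
    rw [← tableMultiplicity_pos_iff hpos, ← hC, Nat.cast_pos]
  constructor
  · rintro ⟨w, ⟨hw, hw'⟩, rfl⟩
    rw [key, hmem] at hw'
    refine hw'.resolve_left ?_
    exact_mod_cast hw.ne'
  · intro hx
    obtain ⟨z, rfl⟩ := hint x hx
    have hz : 0 < z := by exact_mod_cast hl.1 _ hx
    lift z to ℕ using hz.le
    rw [Int.cast_natCast] at hx ⊢
    refine ⟨z, ⟨by exact_mod_cast hz, ?_⟩, rfl⟩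
    rw [key, hmem]
    exact Or.inr hx

lemma oddTable_pos {p : ℚ} (hp : 3 ≤ p) (j : ℕ) : ∀ r ∈ oddTable p (2 * j + 3), 0 < r.2 := by
  obtain ⟨u, hu⟩ : ∃ u, u = p ^ j := ⟨_, rfl⟩
  have hu1 : 1 ≤ u := by rw [hu]; exact one_le_pow₀ (by linarith)
  rw [oddTable_eq p j u hu]
  -- After the shifts `p = s + 3` and `u = t + 1` the expanded polynomials have no negative
  -- coefficients, so `positivity` applies.
  obtain ⟨s, hs, rfl⟩ : ∃ s, 0 ≤ s ∧ p = s + 3 := ⟨p - 3, by linarith, by ring⟩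
  obtain ⟨t, ht, rfl⟩ : ∃ t, 0 ≤ t ∧ u = t + 1 := ⟨u - 1, by linarith, by ring⟩
  clear hu hp hu1
  have h1 : 0 < (s + 3) ^ 3 * (t + 1) ^ 2 - 1 := by ring_nf; positivity
  have h2 : 0 < 2 * ((s + 3) ^ 5 * (t + 1) ^ 4) - 2 * ((s + 3) ^ 4 * (t + 1) ^ 4) +
      (s + 3) ^ 3 * (t + 1) ^ 4 - (s + 3) ^ 2 * (t + 1) ^ 4 + (s + 3) ^ 2 * (t + 1) ^ 2 -
      (s + 3) * (t + 1) ^ 2 + (t + 1) ^ 2 + 1 := by ring_nf; positivity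
  have h3 : 0 < (s + 3) * (t + 1) - 1 := by ring_nf; positivity
  have h4 : 0 < (s + 3) ^ 5 * (t + 1) ^ 2 - (s + 3) ^ 4 * (t + 1) ^ 2 - (s + 3) * (t + 1) ^ 2
        + (s + 3) ^ 2 * (t + 1) - (t + 1) + (s + 3) ^ 2 := by ring_nf; positivity
  have h5 : 0 < (s + 3) ^ 5 * (t + 1) ^ 2 - (s + 3) ^ 4 * (t + 1) ^ 2 - (s + 3) * (t + 1) ^ 2
        - (s + 3) ^ 2 * (t + 1) + (t + 1) + (s + 3) ^ 2 := by ring_nf; positivity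
  have h6 : 0 < (s + 3) ^ 2 * (t + 1) ^ 2 - 1 := by ring_nf; positivity
  have h7 : 0 < s + 3 - 1 := by linarith
  simp only [List.mem_cons, List.not_mem_nil, or_false, forall_eq_or_imp, forall_eq]
  refine ⟨?_, ?_, ?_, ?_, ?_, ?_, ?_, ?_, ?_⟩ <;> positivity

lemma evenTable_pos {p : ℚ} (hp : 3 ≤ p) (j : ℕ) : ∀ r ∈ evenTable p (2 * j + 4), 0 < r.2 := by
  obtain ⟨u, hu⟩ : ∃ u, u = p ^ j := ⟨_, rfl⟩
  have hu1 : 1 ≤ u := by rw [hu]; exact one_le_pow₀ (by linarith)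
  rw [evenTable_eq p j u hu]
  obtain ⟨s, hs, rfl⟩ : ∃ s, 0 ≤ s ∧ p = s + 3 := ⟨p - 3, by linarith, by ring⟩
  obtain ⟨t, ht, rfl⟩ : ∃ t, 0 ≤ t ∧ u = t + 1 := ⟨u - 1, by linarith, by ring⟩
  clear hu hp hu1
  have h1 : 0 < (s + 3) ^ 4 * (t + 1) ^ 2 - 1 := by ring_nf; positivity
  have h2 : 0 < (s + 3) ^ 7 * (t + 1) ^ 4 - (s + 3) ^ 6 * (t + 1) ^ 4 +
      2 * ((s + 3) ^ 5 * (t + 1) ^ 4) - (s + 3) ^ 2 * (t + 1) ^ 2 + 1 := by ring_nf; positivity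
  have h3 : 0 < (s + 3) * (t + 1) - 1 := by ring_nf; positivity
  have h4 : 0 < (s + 3) ^ 4 * (t + 1) ^ 2 - (s + 3) ^ 3 * (t + 1) ^ 2 - (s + 3) ^ 2 * (t + 1) ^ 2
        + (s + 3) ^ 2 * (t + 1) - (s + 3) * (t + 1) + 1 := by ring_nf; positivity
  have h5 : 0 < (s + 3) ^ 4 * (t + 1) ^ 2 - (s + 3) ^ 3 * (t + 1) ^ 2 - (s + 3) ^ 2 * (t + 1) ^ 2
        - (s + 3) ^ 2 * (t + 1) + (s + 3) * (t + 1) + 1 := by ring_nf; positivity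
  have h6 : 0 < (s + 3) ^ 6 * (t + 1) ^ 2 - (s + 3) ^ 4 * (t + 1) ^ 2 + (s + 3) ^ 3 * (t + 1) ^ 2
        + (s + 3) ^ 2 * (t + 1) - (s + 3) * (t + 1) - 1 := by ring_nf; positivity
  have h7 : 0 < (s + 3) ^ 6 * (t + 1) ^ 2 - (s + 3) ^ 4 * (t + 1) ^ 2 + (s + 3) ^ 3 * (t + 1) ^ 2
        - (s + 3) ^ 2 * (t + 1) + (s + 3) * (t + 1) - 1 := by ring_nf; positivity
  have h8 : 0 < (s + 3) ^ 2 * (t + 1) - 1 := by ring_nf; positivity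
  have h9 : 0 < (s + 3) ^ 2 - 1 := by ring_nf; positivity
  have h10 : 0 < s + 3 - 1 := by linarith
  simp only [List.mem_cons, List.not_mem_nil, or_false, forall_eq_or_imp, forall_eq]
  refine ⟨?_, ?_, ?_, ?_, ?_, ?_, ?_, ?_, ?_, ?_, ?_⟩ <;> positivity

lemma numNonzeroWeights_odd {K ι : Type*} [Field K] [DecidableEq K] [Fintype ι]
    {C : Submodule K (ι → K)} {p : ℕ} (hp : 3 ≤ p) (j : ℕ)
    (hC : ∀ w : ℕ, (weightCount C w : ℚ) = tableMultiplicity (oddTable p (2 * j + 3)) w) :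
    numNonzeroWeights C = if j = 0 then 7 else 8 := by
  have hp' : (3 : ℚ) ≤ p := by exact_mod_cast hp
  have hpos := oddTable_pos hp' j
  obtain ⟨v, hv⟩ : ∃ v : ℕ, v = p ^ j := ⟨_, rfl⟩
  have hu : (v : ℚ) = (p : ℚ) ^ j := by rw [hv]; push_cast; rfl
  have hv1 : (1 : ℚ) ≤ v := by rw [hu]; exact one_le_pow₀ (by linarith)
  have hpv : (0 : ℚ) < p * v := by positivity
  have hppv : (p : ℚ) * v * 3 ≤ p * v * p := mul_le_mul_of_nonneg_left hp' hpv.le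
  -- This is the positivity of the smallest nonzero weight.
  have hc : (p : ℚ) * v * p < p ^ 2 * v ^ 2 * (p - 1) := by
    have : (p : ℚ) * v * p * 1 < (p : ℚ) * v * p * (v * (p - 1)) := by
      refine mul_lt_mul_of_pos_left ?_ (by positivity)
      nlinarith
    linarith
  rw [oddTable_eq _ j _ hu] at hC hpos
  have hchain : ((0 : ℚ) :: [(p : ℚ) ^ 2 * v * (p * v - v - 1),
      p * v * (p ^ 2 * v - p * v - p + 1), p * v * (p ^ 2 * v - p * v - 1),
      p ^ 2 * v ^ 2 * (p - 1), p * v * (p ^ 2 * v - p * v + 1),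
      p * v * (p ^ 2 * v - p * v + p - 1), p ^ 2 * v * (p * v - v + 1)]).IsChain (· < ·) := by
    simp only [List.isChain_cons_cons, List.isChain_singleton, and_true]
    refine ⟨?_, ?_, ?_, ?_, ?_, ?_, ?_⟩ <;> linarith
  split_ifs with hj
  · have hv' : (v : ℚ) = 1 := by rw [hu, hj, pow_zero]
    refine (numNonzeroWeights_eq_length hC hpos (List.isChain_iff_pairwise.1 hchain) ?_ ?_).trans
      rfl
    · intro x
      -- For `m = 3` two table lines share the weight `p ^ 3`, which loses one weight.
      have e : (p : ℚ) ^ 3 * v ^ 2 = p ^ 2 * v * (p * v - v + 1) := by rw [hv']; ring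
      simp only [List.map_cons, List.map_nil, List.mem_cons, List.not_mem_nil, or_false, e]
      generalize (x = ((p : ℚ) ^ 2 * v * (p * v - v - 1))) = P0
      generalize (x = ((p : ℚ) * v * (p ^ 2 * v - p * v - p + 1))) = P1
      generalize (x = ((p : ℚ) * v * (p ^ 2 * v - p * v - 1))) = P2
      generalize (x = ((p : ℚ) ^ 2 * v ^ 2 * (p - 1))) = P3
      generalize (x = ((p : ℚ) * v * (p ^ 2 * v - p * v + 1))) = P4
      generalize (x = ((p : ℚ) * v * (p ^ 2 * v - p * v + p - 1))) = P5
      generalize (x = ((p : ℚ) ^ 2 * v * (p * v - v + 1))) = P6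
      grind
    · simp only [List.mem_cons, List.not_mem_nil, or_false, forall_eq_or_imp, forall_eq]
      exact ⟨⟨p ^ 2 * v * (p * v - v - 1), by push_cast; rfl⟩,
        ⟨p * v * (p ^ 2 * v - p * v - p + 1), by push_cast; rfl⟩,
        ⟨p * v * (p ^ 2 * v - p * v - 1), by push_cast; rfl⟩,
        ⟨p ^ 2 * v ^ 2 * (p - 1), by push_cast; rfl⟩,
        ⟨p * v * (p ^ 2 * v - p * v + 1), by push_cast; rfl⟩,
        ⟨p * v * (p ^ 2 * v - p * v + p - 1), by push_cast; rfl⟩,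
        ⟨p ^ 2 * v * (p * v - v + 1), by push_cast; rfl⟩⟩
  · have hv2 : (1 : ℚ) < v := by rw [hu]; exact one_lt_pow₀ (by linarith) hj
    have hlast : (p : ℚ) ^ 2 * v * (p * v - v + 1) < p ^ 3 * v ^ 2 := by
      have : (p : ℚ) ^ 2 * v * 1 < p ^ 2 * v * v := mul_lt_mul_of_pos_left hv2 (by positivity)
      linarith
    have hchain' : ((0 : ℚ) :: [(p : ℚ) ^ 2 * v * (p * v - v - 1),
        p * v * (p ^ 2 * v - p * v - p + 1), p * v * (p ^ 2 * v - p * v - 1),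
        p ^ 2 * v ^ 2 * (p - 1), p * v * (p ^ 2 * v - p * v + 1),
        p * v * (p ^ 2 * v - p * v + p - 1), p ^ 2 * v * (p * v - v + 1),
        p ^ 3 * v ^ 2]).IsChain (· < ·) := by
      simp only [List.isChain_cons_cons, List.isChain_singleton, and_true] at hchain ⊢
      simp only [hchain, hlast, and_true]
    refine (numNonzeroWeights_eq_length hC hpos (List.isChain_iff_pairwise.1 hchain') ?_ ?_).trans
      rfl
    · intro x
      simp only [List.map_cons, List.map_nil, List.mem_cons, List.not_mem_nil, or_false]
      generalize (x = ((p : ℚ) ^ 2 * v * (p * v - v - 1))) = P0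
      generalize (x = ((p : ℚ) * v * (p ^ 2 * v - p * v - p + 1))) = P1
      generalize (x = ((p : ℚ) * v * (p ^ 2 * v - p * v - 1))) = P2
      generalize (x = ((p : ℚ) ^ 2 * v ^ 2 * (p - 1))) = P3
      generalize (x = ((p : ℚ) * v * (p ^ 2 * v - p * v + 1))) = P4
      generalize (x = ((p : ℚ) * v * (p ^ 2 * v - p * v + p - 1))) = P5
      generalize (x = ((p : ℚ) ^ 2 * v * (p * v - v + 1))) = P6
      generalize (x = ((p : ℚ) ^ 3 * v ^ 2)) = P7
      exact Iff.of_eq (by ac_rfl)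
    · simp only [List.mem_cons, List.not_mem_nil, or_false, forall_eq_or_imp, forall_eq]
      exact ⟨⟨p ^ 2 * v * (p * v - v - 1), by push_cast; rfl⟩,
        ⟨p * v * (p ^ 2 * v - p * v - p + 1), by push_cast; rfl⟩,
        ⟨p * v * (p ^ 2 * v - p * v - 1), by push_cast; rfl⟩,
        ⟨p ^ 2 * v ^ 2 * (p - 1), by push_cast; rfl⟩,
        ⟨p * v * (p ^ 2 * v - p * v + 1), by push_cast; rfl⟩,
        ⟨p * v * (p ^ 2 * v - p * v + p - 1), by push_cast; rfl⟩,
        ⟨p ^ 2 * v * (p * v - v + 1), by push_cast; rfl⟩,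
        ⟨p ^ 3 * v ^ 2, by push_cast; rfl⟩⟩

lemma numNonzeroWeights_even {K ι : Type*} [Field K] [DecidableEq K] [Fintype ι]
    {C : Submodule K (ι → K)} {p : ℕ} (hp : 3 ≤ p) (j : ℕ)
    (hC : ∀ w : ℕ, (weightCount C w : ℚ) = tableMultiplicity (evenTable p (2 * j + 4)) w) :
    numNonzeroWeights C = 10 := by
  have hp' : (3 : ℚ) ≤ p := by exact_mod_cast hp
  have hpos := evenTable_pos hp' j
  obtain ⟨v, hv⟩ : ∃ v : ℕ, v = p ^ j := ⟨_, rfl⟩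
  have hu : (v : ℚ) = (p : ℚ) ^ j := by rw [hv]; push_cast; rfl
  have hv1 : (1 : ℚ) ≤ v := by rw [hu]; exact one_le_pow₀ (by linarith)
  have hpv : (0 : ℚ) < p * v := by positivity
  have hppv : (p : ℚ) * v * 3 ≤ p * v * p := mul_le_mul_of_nonneg_left hp' hpv.le
  have hpppv : (p : ℚ) * v * p * 3 ≤ p * v * p * p :=
    mul_le_mul_of_nonneg_left hp' (by positivity)
  -- This is the positivity of the smallest nonzero weight; `hc'` places the second largest below `p
  -- ^ m`.
  have hc : (p : ℚ) ^ 2 * v * (p - 1) < p ^ 3 * v ^ 2 * (p - 1) := by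
    have : (p : ℚ) ^ 2 * v * (p - 1) * 1 < p ^ 2 * v * (p - 1) * (v * p) := by
      refine mul_lt_mul_of_pos_left (by nlinarith) (mul_pos (by positivity) (by linarith))
    linarith
  have hc' : (p : ℚ) ^ 2 * v * (p - 1) < p ^ 3 * v ^ 2 := by
    have : (p : ℚ) ^ 2 * v * (p - 1) < p ^ 2 * v * (v * p) := by
      refine mul_lt_mul_of_pos_left (by nlinarith) (by positivity)
    linarith
  rw [evenTable_eq _ j _ hu] at hC hpos
  have hchain : ((0 : ℚ) :: [(p : ℚ) ^ 2 * v * (p ^ 2 * v - p * v - p + 1),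
      p ^ 2 * v * (p ^ 2 * v - p * v - 1),
      p * v * (p ^ 3 * v - p ^ 2 * v - p + 1), p * v * (p ^ 3 * v - p ^ 2 * v - 1),
      p ^ 3 * v ^ 2 * (p - 1), p * v * (p ^ 3 * v - p ^ 2 * v + 1),
      p * v * (p ^ 3 * v - p ^ 2 * v + p - 1), p ^ 2 * v * (p ^ 2 * v - p * v + 1),
      p ^ 2 * v * (p ^ 2 * v - p * v + p - 1), p ^ 4 * v ^ 2]).IsChain (· < ·) := by
    simp only [List.isChain_cons_cons, List.isChain_singleton, and_true]
    refine ⟨?_, ?_, ?_, ?_, ?_, ?_, ?_, ?_, ?_, ?_⟩ <;> linarith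
  refine (numNonzeroWeights_eq_length hC hpos (List.isChain_iff_pairwise.1 hchain) ?_ ?_).trans rfl
  · intro x
    simp only [List.map_cons, List.map_nil, List.mem_cons, List.not_mem_nil, or_false]
    generalize (x = ((p : ℚ) ^ 2 * v * (p ^ 2 * v - p * v - p + 1))) = P0
    generalize (x = ((p : ℚ) ^ 2 * v * (p ^ 2 * v - p * v - 1))) = P1
    generalize (x = ((p : ℚ) * v * (p ^ 3 * v - p ^ 2 * v - p + 1))) = P2
    generalize (x = ((p : ℚ) * v * (p ^ 3 * v - p ^ 2 * v - 1))) = P3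
    generalize (x = ((p : ℚ) ^ 3 * v ^ 2 * (p - 1))) = P4
    generalize (x = ((p : ℚ) * v * (p ^ 3 * v - p ^ 2 * v + 1))) = P5
    generalize (x = ((p : ℚ) * v * (p ^ 3 * v - p ^ 2 * v + p - 1))) = P6
    generalize (x = ((p : ℚ) ^ 2 * v * (p ^ 2 * v - p * v + 1))) = P7
    generalize (x = ((p : ℚ) ^ 2 * v * (p ^ 2 * v - p * v + p - 1))) = P8
    generalize (x = ((p : ℚ) ^ 4 * v ^ 2)) = P9
    exact Iff.of_eq (by ac_rfl)
  · simp only [List.mem_cons, List.not_mem_nil, or_false, forall_eq_or_imp, forall_eq]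
    exact ⟨⟨p ^ 2 * v * (p ^ 2 * v - p * v - p + 1), by push_cast; rfl⟩,
      ⟨p ^ 2 * v * (p ^ 2 * v - p * v - 1), by push_cast; rfl⟩,
      ⟨p * v * (p ^ 3 * v - p ^ 2 * v - p + 1), by push_cast; rfl⟩,
      ⟨p * v * (p ^ 3 * v - p ^ 2 * v - 1), by push_cast; rfl⟩,
      ⟨p ^ 3 * v ^ 2 * (p - 1), by push_cast; rfl⟩,
      ⟨p * v * (p ^ 3 * v - p ^ 2 * v + 1), by push_cast; rfl⟩,
      ⟨p * v * (p ^ 3 * v - p ^ 2 * v + p - 1), by push_cast; rfl⟩,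
      ⟨p ^ 2 * v * (p ^ 2 * v - p * v + 1), by push_cast; rfl⟩,
      ⟨p ^ 2 * v * (p ^ 2 * v - p * v + p - 1), by push_cast; rfl⟩,
      ⟨p ^ 4 * v ^ 2, by push_cast; rfl⟩⟩

end NumberOfWeights

/-! ### The parametrization of the code and its weight counts. -/

section TraceWords

open Finset

variable {K F : Type*} [Field K] [Field F] [Algebra K F]

/-- The word `(Tr(a σ(x) x + b x² + c x) + h)_x` as a linear function of `(a, b, c, h)`. -/
noncomputable def traceWord (σ : F ≃ₐ[K] F) : (F × F × F × K) →ₗ[K] (F → K) where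
  toFun v x := traceQuadForm σ v.1 v.2.1 x + Algebra.trace K F (v.2.2.1 * x) + v.2.2.2
  map_add' v w := by
    funext x
    simp only [Prod.fst_add, Prod.snd_add, traceQuadForm_apply, add_mul, map_add, Pi.add_apply]
    ring
  map_smul' r v := by
    funext x
    simp only [Prod.smul_fst, Prod.smul_snd, traceQuadForm_apply, smul_mul_assoc, map_add,
      map_smul, Pi.smul_apply, smul_eq_mul, RingHom.id_apply]
    ring

lemma traceWord_apply (σ : F ≃ₐ[K] F) (v : F × F × F × K) (x : F) : traceWord σ v x =
    traceQuadForm σ v.1 v.2.1 x + Algebra.trace K F (v.2.2.1 * x) + v.2.2.2 := rfl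

variable [Fintype K] [DecidableEq K] [Fintype F] [DecidableEq F]

/-- Comparing `x` with `-x` separates the quadratic part from the linear one. A vanishing form has a
radical of dimension at least `3`, against the bound `2` for `(a, b) ≠ 0`. -/
lemma traceWord_injective (hK : ringChar K ≠ 2) {σ : F ≃ₐ[K] F}
    (hσ : ∀ x, σ x = x → ∃ c : K, algebraMap K F c = x) (hm : 3 ≤ Module.finrank K F) :
    Function.Injective (traceWord σ) := by
  rw [injective_iff_map_eq_zero]
  rintro ⟨a, b, c, h⟩ H
  have h2K : (2 : K) ≠ 0 := Ring.two_ne_zero hK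
  have h2 : (2 : F) ≠ 0 := by
    rw [← map_ofNat (algebraMap K F)]
    simpa using h2K
  have H' : ∀ x, traceQuadForm σ a b x + Algebra.trace K F (c * x) + h = 0 := congrFun H
  have hh : h = 0 := by simpa using H' 0
  have hQ : ∀ x, traceQuadForm σ a b x = 0 := by
    intro x
    have h1 := H' x
    have h3 := H' (-x)
    rw [QuadraticMap.map_neg, mul_neg, map_neg] at h3
    have : (2 : K) * traceQuadForm σ a b x = 0 := by linear_combination h1 + h3 - 2 * hh
    exact (mul_eq_zero.1 this).resolve_left h2K
  have hc : c = 0 := eq_zero_of_forall_trace_mul (K := K) fun x => by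
    linear_combination H' x - hQ x - hh
  have hL : tracePolar σ a b = 0 := by
    ext x
    apply eq_zero_of_forall_trace_mul (K := K)
    intro y
    rw [← polar_traceQuadForm, QuadraticMap.polar, hQ, hQ, hQ]
    ring
  have hab : a = 0 ∧ b = 0 := by
    by_contra hne
    have := finrank_ker_tracePolar_le hσ h2 (not_and_or.1 hne)
    rw [hL, LinearMap.ker_zero, finrank_top] at this
    omega
  simp [hab.1, hab.2, hc, hh]

lemma finrank_range_traceWord (hK : ringChar K ≠ 2) {σ : F ≃ₐ[K] F}
    (hσ : ∀ x, σ x = x → ∃ c : K, algebraMap K F c = x) (hm : 3 ≤ Module.finrank K F) :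
    Module.finrank K (LinearMap.range (traceWord σ)) = 3 * Module.finrank K F + 1 := by
  rw [LinearMap.finrank_range_of_inj (traceWord_injective hK hσ hm)]
  simp only [Module.finrank_prod, Module.finrank_self]
  ring

lemma hammingNorm_eq_card_sub_levelCard {ι : Type*} [Fintype ι] (f : ι → K) :
    (hammingNorm f : ℚ) = Fintype.card ι - levelCard f 0 := by
  have := card_filter_add_card_filter_not (s := (univ : Finset ι)) (fun x => f x = 0)
  rw [card_univ] at this
  rw [hammingNorm, levelCard, ← this]
  push_cast
  ring

lemma weightCount_range_traceWord {σ : F ≃ₐ[K] F} (hinj : Function.Injective (traceWord σ))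
    (w : ℕ) :
    (weightCount (LinearMap.range (traceWord σ)) w : ℚ) =
      ∑ a : F, ∑ b : F, ∑ c : F, ∑ h : K,
        if (Fintype.card F : ℚ) - levelCard
          (fun x => traceQuadForm σ a b x + Algebra.trace K F (c * x) + h) 0 = w
        then (1 : ℚ) else 0 := by
  have hset : {f : F → K | f ∈ LinearMap.range (traceWord σ) ∧ hammingNorm f = w} =
      traceWord σ '' ({v | hammingNorm (traceWord σ v) = w} : Finset (F × F × F × K)) := by
    ext f
    simp only [Set.mem_ofPred_eq, LinearMap.mem_range, Set.mem_image, coe_filter, mem_univ,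
      true_and]
    constructor
    · rintro ⟨⟨v, rfl⟩, hv⟩
      exact ⟨v, hv, rfl⟩
    · rintro ⟨v, hv, rfl⟩
      exact ⟨⟨v, rfl⟩, hv⟩
  rw [weightCount, hset, Set.ncard_image_of_injective _ hinj, Set.ncard_coe_finset,
    ← sum_boole]
  simp only [Fintype.sum_prod_type]
  refine sum_congr rfl fun a _ => sum_congr rfl fun b _ => sum_congr rfl fun c _ =>
    sum_congr rfl fun h _ => ?_
  congr 1
  rw [← Nat.cast_inj (R := ℚ), hammingNorm_eq_card_sub_levelCard]
  rfl

lemma exists_weightCount_eq (hK : ringChar K ≠ 2) {σ : F ≃ₐ[K] F}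
    (hσ : ∀ x, σ x = x → ∃ c : K, algebraMap K F c = x) (hm : 3 ≤ Module.finrank K F) {p q : ℚ}
    (hp : p = Fintype.card K) (hq : q = Fintype.card F) :
    ∃ N, RankDistribution p q (Module.finrank K F) N ∧ ∀ w : ℕ,
      (weightCount (LinearMap.range (traceWord σ)) w : ℚ) =
        let ψ : ℚ → ℚ := fun z => if z = w then 1 else 0
        ψ 0 + (p - 1) * ψ q + (q - 1) * p * ψ (q - q / p) +
        ∑ d ∈ range 3, (N d 1 * formContribution p q (fun z => ψ (q - z))
            (Module.finrank K F - d) 1 +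
          N d (-1) * formContribution p q (fun z => ψ (q - z))
            (Module.finrank K F - d) (-1)) := by
  obtain ⟨N, h0, h1, h2, h3, h4, h5⟩ := exists_rank_distribution hK hσ hp hq rfl
  refine ⟨N, ⟨h0, h1, h2, h3, h4⟩, fun w => ?_⟩
  rw [weightCount_range_traceWord (traceWord_injective hK hσ hm), ← hq]
  have := h5 fun z => if q - z = w then 1 else 0
  rw [this]
  simp only [sub_self, sub_zero]

lemma weightCount_odd (hK : ringChar K ≠ 2) {σ : F ≃ₐ[K] F}
    (hσ : ∀ x, σ x = x → ∃ c : K, algebraMap K F c = x) (hm : 3 ≤ Module.finrank K F)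
    (hodd : Odd (Module.finrank K F)) (w : ℕ) :
    (weightCount (LinearMap.range (traceWord σ)) w : ℚ) =
      tableMultiplicity (oddTable (Fintype.card K) (Module.finrank K F)) w := by
  obtain ⟨N, hN, h⟩ := exists_weightCount_eq hK hσ hm rfl rfl
  rw [h, tableMultiplicity_eq_sum]
  have hq : (Fintype.card F : ℚ) = (Fintype.card K : ℚ) ^ Module.finrank K F := by
    rw [Module.card_eq_pow_finrank (K := K) (V := F)]; push_cast; rfl
  obtain ⟨j, hj⟩ : ∃ j, Module.finrank K F = 2 * j + 3 := by
    obtain ⟨k, hk⟩ := hodd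
    exact ⟨k - 1, by omega⟩
  rw [hj] at hN hq ⊢
  exact hN.sum_odd (by exact_mod_cast Fintype.one_lt_card) hq fun z => if z = (w : ℚ) then 1 else 0

lemma weightCount_even (hK : ringChar K ≠ 2) {σ : F ≃ₐ[K] F}
    (hσ : ∀ x, σ x = x → ∃ c : K, algebraMap K F c = x) (hm : 3 ≤ Module.finrank K F)
    (heven : Even (Module.finrank K F)) (w : ℕ) :
    (weightCount (LinearMap.range (traceWord σ)) w : ℚ) =
      tableMultiplicity (evenTable (Fintype.card K) (Module.finrank K F)) w := by
  obtain ⟨N, hN, h⟩ := exists_weightCount_eq hK hσ hm rfl rfl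
  rw [h, tableMultiplicity_eq_sum]
  have hq : (Fintype.card F : ℚ) = (Fintype.card K : ℚ) ^ Module.finrank K F := by
    rw [Module.card_eq_pow_finrank (K := K) (V := F)]; push_cast; rfl
  obtain ⟨j, hj⟩ : ∃ j, Module.finrank K F = 2 * j + 4 := by
    obtain ⟨k, hk⟩ := heven
    exact ⟨k - 2, by omega⟩
  rw [hj] at hN hq ⊢
  exact hN.sum_even (by exact_mod_cast Fintype.one_lt_card) hq fun z => if z = (w : ℚ) then 1 else 0

end TraceWords

/-! ### The power of Frobenius that realizes the exponent `p ^ l + 1`. -/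

section FrobeniusPower

variable (p l : ℕ) [Fact p.Prime] (F : Type*) [Field F] [Fintype F] [Algebra (ZMod p) F]

/-- The automorphism `x ↦ x ^ (p ^ l)`. -/
noncomputable def frobPow : F ≃ₐ[ZMod p] F :=
  FiniteField.frobeniusAlgEquivOfAlgebraic (ZMod p) F ^ l

variable {F}

lemma frobPow_apply (x : F) : frobPow p l F x = x ^ p ^ l := by
  have h := congrFun (FiniteField.coe_frobeniusAlgEquivOfAlgebraic_iterate (ZMod p) F l) x
  rw [ZMod.card] at h
  rw [frobPow, ← h]
  exact congrFun (AlgEquiv.coe_pow _ l) x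

variable {p l}

/-- Under `y ↦ y ^ p` the point `x` has periods `l` and `m`, hence period `gcd(m, l) = 1`; so `x ^ p
= x`, which characterizes the prime field. -/
lemma exists_algebraMap_of_frobPow_eq {m : ℕ} (hml : Nat.gcd m l = 1)
    (hF : Fintype.card F = p ^ m) (x : F) (hx : frobPow p l F x = x) :
    ∃ c : ZMod p, algebraMap (ZMod p) F c = x := by
  have hit : ∀ n : ℕ, (fun y : F => y ^ p)^[n] x = x ^ p ^ n := by
    intro n
    induction n with
    | zero => simp
    | succ n ih => rw [Function.iterate_succ_apply', ih, ← pow_mul, ← pow_succ]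
  have h1 : Function.IsPeriodicPt (fun y : F => y ^ p) l x := by
    rw [Function.IsPeriodicPt, Function.IsFixedPt, hit, ← frobPow_apply, hx]
  have h2 : Function.IsPeriodicPt (fun y : F => y ^ p) m x := by
    rw [Function.IsPeriodicPt, Function.IsFixedPt, hit, ← hF, FiniteField.pow_card]
  have h3 := h2.gcd h1
  rw [hml, Function.IsPeriodicPt, Function.IsFixedPt, hit, pow_one] at h3
  have : CharP F p := charP_of_injective_algebraMap' (ZMod p) p
  have h4 := (Subfield.mem_bot_iff_pow_eq_self (F := F) (p := p)).2 h3
  obtain ⟨n, hn⟩ := (mem_bot_iff_intCast p F).1 h4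
  exact ⟨n, by rw [map_intCast, hn]⟩

lemma traceCode_eq_range : traceCode p l F = LinearMap.range (traceWord (frobPow p l F)) := by
  ext w
  rw [LinearMap.mem_range]
  have key : ∀ (a b c : F) (h : ZMod p) (x : F), traceWord (frobPow p l F) (a, b, c, h) x =
      Algebra.trace (ZMod p) F (a * x ^ (p ^ l + 1) + b * x ^ 2 + c * x) + h := by
    intro a b c h x
    rw [traceWord_apply, traceQuadForm_apply, frobPow_apply, map_add _ (_ + _), pow_succ x (p ^ l),
      mul_assoc a]
  constructor
  · rintro ⟨a, b, c, h, hw⟩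
    exact ⟨(a, b, c, h), funext fun x => by rw [key, hw]⟩
  · rintro ⟨⟨a, b, c, h⟩, rfl⟩
    exact ⟨a, b, c, h, key a b c h⟩

end FrobeniusPower

/-! ### Cyclic codes, their dimension and their trace words. -/

section CyclicCodes

open Finset Polynomial

variable {K : Type*} [Field K]

lemma dualCode_dualCode {ι : Type*} [Fintype ι] (C : Submodule K (ι → K)) :
    dualCode (dualCode C) = C := by
  classical
  let B : LinearMap.BilinForm K (ι → K) := dotProductBilin K K
  have hB : ∀ x y, B x y = ∑ i, x i * y i := fun x y => rfl
  have hsymm : ∀ x y, B x y = B y x := fun x y => by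
    rw [hB, hB]; exact sum_congr rfl fun i _ => mul_comm _ _
  have hrefl : B.IsRefl := fun x y h => by rw [hsymm, h]
  have hsep : ∀ x, (∀ y, B x y = 0) → x = 0 := by
    intro x hx
    funext i
    simpa [hB, Pi.single_apply] using hx (Pi.single i 1)
  have hnd : B.Nondegenerate := ⟨hsep, fun y hy => hsep y fun x => by rw [hsymm, hy]⟩
  have hdual : ∀ D : Submodule K (ι → K), dualCode D = B.orthogonal D := fun D => rfl
  rw [hdual, hdual, LinearMap.BilinForm.orthogonal_orthogonal hnd hrefl]

/-- The polynomial attached to a word, as a linear map. -/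
noncomputable def wordPoly (n : ℕ) : (Fin n → K) →ₗ[K] K[X] :=
  ∑ i : Fin n, Polynomial.monomial (i : ℕ) ∘ₗ LinearMap.proj i

lemma wordPoly_apply {n : ℕ} (c : Fin n → K) :
    wordPoly n c = ∑ i : Fin n, Polynomial.C (c i) * Polynomial.X ^ (i : ℕ) := by
  simp [wordPoly, C_mul_X_pow_eq_monomial]

lemma wordPoly_injective (n : ℕ) : Function.Injective (wordPoly (K := K) n) := by
  intro c d h
  funext i
  have := congrArg (fun f => coeff f (i : ℕ)) h
  simpa [wordPoly_apply, finsetSum_coeff, coeff_C_mul, coeff_X_pow, Fin.val_inj] using this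

lemma degree_wordPoly_lt {n : ℕ} (c : Fin n → K) : (wordPoly n c).degree < n := by
  rw [wordPoly_apply]
  refine (degree_sum_le _ _).trans_lt ((Finset.sup_lt_iff (WithBot.bot_lt_coe n)).2 fun i _ => ?_)
  exact (degree_C_mul_X_pow_le _ _).trans_lt (Nat.cast_lt.2 i.2)

lemma mem_cyclicCode_iff {n : ℕ} {h g : K[X]} (hh : h ≠ 0) (hg : X ^ n - 1 = h * g)
    (c : Fin n → K) : c ∈ cyclicCode n h ↔ g ∣ wordPoly n c := by
  rw [wordPoly_apply, ← mul_div_cancel_left₀ g hh, ← hg]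
  rfl

/-- Every codeword polynomial is the generator times a factor of degree below that of `h`. -/
lemma finrank_cyclicCode_le {n : ℕ} (hn : 0 < n) {h : K[X]} (hdvd : h ∣ X ^ n - 1) :
    Module.finrank K (cyclicCode n h) ≤ h.natDegree := by
  obtain ⟨g, hg⟩ := hdvd
  have hne : (X ^ n - 1 : K[X]) ≠ 0 := X_pow_sub_C_ne_zero hn 1
  have hh : h ≠ 0 := fun H => hne (by rw [hg, H, zero_mul])
  have hg0 : g ≠ 0 := fun H => hne (by rw [hg, H, mul_zero])
  have hdeg : n = h.natDegree + g.natDegree := by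
    rw [← natDegree_mul hh hg0, ← hg, ← C_1, natDegree_X_pow_sub_C]
  have hle : (cyclicCode n h).map (wordPoly n) ≤
      (degreeLT K h.natDegree).map (LinearMap.mulLeft K g) := by
    rintro _ ⟨c, hc, rfl⟩
    obtain ⟨f, hf⟩ := (mem_cyclicCode_iff hh hg c).1 hc
    refine ⟨f, mem_degreeLT.2 ?_, hf.symm⟩
    have hlt := degree_wordPoly_lt c
    by_cases hf0 : f = 0
    · rw [hf0, degree_zero]; exact WithBot.bot_lt_coe _
    · rw [hf, degree_eq_natDegree (mul_ne_zero hg0 hf0), natDegree_mul hg0 hf0] at hlt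
      rw [degree_eq_natDegree hf0]
      have : g.natDegree + f.natDegree < n := by exact_mod_cast hlt
      exact_mod_cast (by omega : f.natDegree < h.natDegree)
  have hfin : FiniteDimensional K (degreeLT K h.natDegree) :=
    (degreeLTEquiv K h.natDegree).symm.finiteDimensional
  have h1 := Submodule.finrank_mono hle
  rw [← ((cyclicCode n h).equivMapOfInjective _ (wordPoly_injective n)).finrank_eq] at h1
  refine h1.trans ((Submodule.finrank_map_le _ _).trans ?_)
  rw [(degreeLTEquiv K h.natDegree).finrank_eq]
  simp

/-- It suffices that the word polynomial vanishes at each `n`-th root of unity `γ` that is not a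
root of `h`. Its value there is a sum over conjugates `τβ` of geometric series with ratio `γ / τβ`,
an `n`-th root of unity other than `1`. The inverse powers of `β` produce this quotient. -/
lemma trace_word_mem_cyclicCode {F : Type*} [Field F] [Algebra K F] [FiniteDimensional K F]
    [IsGalois K F] {n : ℕ} (hn : 0 < n) {α : F} (hα : IsPrimitiveRoot α n) {h : K[X]}
    (hdvd : h ∣ X ^ n - 1) {β : F} (hβ : β ^ n = 1) (hroot : aeval β h = 0) (b : F) :
    (fun t : Fin n => Algebra.trace K F (b * (β ^ (t : ℕ))⁻¹)) ∈ cyclicCode n h := by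
  obtain ⟨g, hg⟩ := hdvd
  have hne : (X ^ n - 1 : K[X]) ≠ 0 := X_pow_sub_C_ne_zero hn 1
  have hh : h ≠ 0 := fun H => hne (by rw [hg, H, zero_mul])
  rw [mem_cyclicCode_iff hh hg, ← mul_dvd_mul_iff_left hh, ← hg,
    ← Polynomial.map_dvd_map' (algebraMap K F)]
  have hprod : (X ^ n - 1 : K[X]).map (algebraMap K F) =
      ∏ ζ ∈ nthRootsFinset n (1 : F), (X - C ζ) := by
    rw [← X_pow_sub_one_eq_prod hn hα]
    simp
  rw [hprod]
  refine Finset.prod_dvd_of_coprime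
    ((pairwise_coprime_X_sub_C Function.injective_id).set_pairwise _) fun γ hγ => ?_
  rw [mem_nthRootsFinset hn] at hγ
  rw [dvd_iff_isRoot, IsRoot, eval_map_algebraMap, map_mul, mul_eq_zero, or_iff_not_imp_left]
  intro hγh
  rw [wordPoly_apply]
  simp only [map_sum, map_mul (aeval γ), aeval_C, map_pow (aeval γ), aeval_X,
    trace_eq_sum_automorphisms, sum_mul]
  rw [sum_comm]
  refine sum_eq_zero fun (τ : F ≃ₐ[K] F) _ => ?_
  have hτβ : τ β ≠ 0 := by
    rw [Ne, map_eq_zero_iff _ τ.injective]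
    rintro rfl
    rw [zero_pow hn.ne'] at hβ
    exact zero_ne_one hβ
  have hne1 : γ / τ β ≠ 1 := by
    intro H
    rw [div_eq_one_iff_eq hτβ] at H
    apply hγh
    rw [H, aeval_algHom_apply τ β h, hroot, map_zero]
  have hterm : ∀ t : Fin n, τ (b * (β ^ (t : ℕ))⁻¹) * γ ^ (t : ℕ) = τ b * (γ / τ β) ^ (t : ℕ) := by
    intro t
    rw [map_mul, map_inv₀, map_pow, div_pow]
    field_simp
  rw [sum_congr rfl fun t _ => hterm t, ← mul_sum, Fin.sum_univ_eq_sum_range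
    (fun t => (γ / τ β) ^ t) n, geom_sum_eq hne1, div_pow, hγ, ← map_pow, hβ]
  simp

lemma minpoly_coprime_or_eq {F : Type*} [Field F] [Algebra K F] [FiniteDimensional K F] (x y : F) :
    IsCoprime (minpoly K x) (minpoly K y) ∨ minpoly K x = minpoly K y := by
  have hx := minpoly.irreducible (Algebra.IsIntegral.isIntegral (R := K) x)
  have hy := minpoly.irreducible (Algebra.IsIntegral.isIntegral (R := K) y)
  refine (dvd_or_isCoprime _ _ hx).symm.imp_right fun h => ?_
  exact eq_of_monic_of_associated (minpoly.monic (Algebra.IsIntegral.isIntegral x))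
    (minpoly.monic (Algebra.IsIntegral.isIntegral y)) (hx.associated_of_dvd hy h)

end CyclicCodes

/-! ### Identification of `C₁` and of the double dual. -/

section Duality

open Finset Polynomial

lemma locator_bijective {F : Type*} [Field F] [Fintype F] {n : ℕ} (hn : Fintype.card F = n + 1)
    {α : F} (hα : IsPrimitiveRoot α n) : Function.Bijective (locator n α) := by
  rw [Fintype.bijective_iff_injective_and_card]
  refine ⟨fun s t hst => ?_, by rw [hn, Fintype.card_fin]⟩
  have hn0 : n ≠ 0 := by
    rintro rfl
    have := Fintype.one_lt_card (α := F)
    omega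
  have hα0 : α ≠ 0 := hα.ne_zero hn0
  unfold locator at hst
  apply Fin.ext
  split_ifs at hst with hs ht ht
  · exact hα.pow_inj hs ht (inv_injective hst)
  · exact absurd hst (inv_ne_zero (pow_ne_zero _ hα0))
  · exact absurd hst.symm (inv_ne_zero (pow_ne_zero _ hα0))
  · omega

variable {p m l : ℕ} [Fact p.Prime] {F : Type*} [Field F] [Fintype F] [Algebra (ZMod p) F]

/-- The word `(Tr(a x^(p^l+1) + b x² + c x))_x` at the points `x = α^(-t)`, `t < n`, as a linear
function of `(a, b, c)`. -/
noncomputable def puncturedWord (p l n : ℕ) [Fact p.Prime] {F : Type*} [Field F] [Fintype F]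
    [Algebra (ZMod p) F] (α : F) : (F × F × F) →ₗ[ZMod p] (Fin n → ZMod p) :=
  LinearMap.funLeft (ZMod p) (ZMod p) (fun t : Fin n => (α ^ (t : ℕ))⁻¹) ∘ₗ
    traceWord (frobPow p l F) ∘ₗ
    LinearMap.prod (LinearMap.fst _ _ _) (LinearMap.prod
      (LinearMap.fst _ _ _ ∘ₗ LinearMap.snd _ _ _)
      (LinearMap.prod (LinearMap.snd _ _ _ ∘ₗ LinearMap.snd _ _ _) 0))

lemma puncturedWord_apply {n : ℕ} (α : F) (v : F × F × F) (t : Fin n) :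
    puncturedWord p l n α v t =
      traceWord (frobPow p l F) (v.1, v.2.1, v.2.2, 0) (α ^ (t : ℕ))⁻¹ := rfl

lemma puncturedWord_eq {n : ℕ} (α : F) (v : F × F × F) (t : Fin n) :
    puncturedWord p l n α v t =
      Algebra.trace (ZMod p) F (v.1 * ((α ^ (p ^ l + 1)) ^ (t : ℕ))⁻¹) +
      Algebra.trace (ZMod p) F (v.2.1 * ((α ^ 2) ^ (t : ℕ))⁻¹) +
      Algebra.trace (ZMod p) F (v.2.2 * (α ^ (t : ℕ))⁻¹) := by
  rw [puncturedWord_apply, traceWord_apply, traceQuadForm_apply, frobPow_apply, map_add, add_zero]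
  have h1 : v.1 * ((α ^ (t : ℕ))⁻¹) ^ p ^ l * (α ^ (t : ℕ))⁻¹ =
      v.1 * ((α ^ (p ^ l + 1)) ^ (t : ℕ))⁻¹ := by
    rw [inv_pow, mul_assoc, ← mul_inv, ← pow_succ, ← pow_mul, ← pow_mul, mul_comm (t : ℕ)]
  have h2 : ((α ^ (t : ℕ))⁻¹) ^ 2 = ((α ^ 2) ^ (t : ℕ))⁻¹ := by
    rw [inv_pow, ← pow_mul, ← pow_mul, mul_comm (t : ℕ)]
  rw [h1, h2]

/-- The only point lost by puncturing is `x = 0`, where a word with `h = 0` vanishes anyway. -/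
lemma traceWord_eq_zero_of_puncturedWord {n : ℕ} (hn : Fintype.card F = n + 1) {α : F}
    (hα : IsPrimitiveRoot α n) {v : F × F × F} (hv : puncturedWord p l n α v = 0) :
    traceWord (frobPow p l F) (v.1, v.2.1, v.2.2, 0) = 0 := by
  funext x
  obtain ⟨t, rfl⟩ := (locator_bijective hn hα).2 x
  unfold locator
  split_ifs with ht
  · exact congrFun hv ⟨t, ht⟩
  · simp [traceWord_apply]

lemma puncturedWord_injective (hinj : Function.Injective (traceWord (frobPow p l F))) {n : ℕ}
    (hn : Fintype.card F = n + 1) {α : F} (hα : IsPrimitiveRoot α n) :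
    Function.Injective (puncturedWord p l n α) := by
  rw [injective_iff_map_eq_zero]
  intro v hv
  have := (injective_iff_map_eq_zero _).1 hinj _ (traceWord_eq_zero_of_puncturedWord hn hα hv)
  simp only [Prod.mk_eq_zero] at this
  exact Prod.ext this.1 (Prod.ext this.2.1 this.2.2.1)

/-- Elements with the same minimal polynomial are Galois conjugate, and the trace does not see
conjugation. -/
lemma trace_inv_pow_eq_of_minpoly_eq {β γ : F} (h : minpoly (ZMod p) β = minpoly (ZMod p) γ)
    (t : ℕ) : Algebra.trace (ZMod p) F (1 * (β ^ t)⁻¹) =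
      Algebra.trace (ZMod p) F (1 * (γ ^ t)⁻¹) := by
  obtain ⟨τ, rfl⟩ := Normal.minpoly_eq_iff_mem_orbit F |>.1 h
  rw [← Algebra.trace_eq_of_algEquiv τ (1 * (γ ^ t)⁻¹)]
  congr 1
  simp [map_inv₀]

/-- The punctured trace words form the cyclic code `C₁`. -/
theorem range_puncturedWord (hinj : Function.Injective (traceWord (frobPow p l F)))
    (hF : Fintype.card F = p ^ m) {α : F} (hα : IsPrimitiveRoot α (p ^ m - 1)) :
    LinearMap.range (puncturedWord p l (p ^ m - 1) α) = codeC1 p m l α := by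
  have hn : Fintype.card F = p ^ m - 1 + 1 := by
    have := Fintype.card_pos (α := F)
    omega
  have hn0 : 0 < p ^ m - 1 := by
    have := Fintype.one_lt_card (α := F)
    omega
  have hU := puncturedWord_injective hinj hn hα
  have hint : ∀ x : F, IsIntegral (ZMod p) x := fun x => Algebra.IsIntegral.isIntegral x
  have hpow : ∀ e : ℕ, (α ^ e) ^ (p ^ m - 1) = 1 := fun e => by
    rw [← pow_mul, mul_comm, pow_mul, hα.pow_eq_one, one_pow]
  have hdvd : ∀ x : F, x ^ (p ^ m - 1) = 1 → minpoly (ZMod p) x ∣ X ^ (p ^ m - 1) - 1 :=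
    fun x hx => minpoly.dvd _ _ (by simp [hx])
  -- Equal minimal polynomials would make two different parameters give the same punctured word,
  -- contrary to injectivity. The same argument gives `c13` and `c23`.
  have c12 : IsCoprime (minpoly (ZMod p) α) (minpoly (ZMod p) (α ^ 2)) := by
    refine (minpoly_coprime_or_eq _ _).resolve_right fun h => ?_
    have : puncturedWord p l (p ^ m - 1) α (0, 0, 1) =
        puncturedWord p l (p ^ m - 1) α (0, 1, 0) := by
      funext t
      rw [puncturedWord_eq, puncturedWord_eq, trace_inv_pow_eq_of_minpoly_eq h]
      simp
    simpa using hU this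
  have c13 : IsCoprime (minpoly (ZMod p) α) (minpoly (ZMod p) (α ^ (p ^ l + 1))) := by
    refine (minpoly_coprime_or_eq _ _).resolve_right fun h => ?_
    have : puncturedWord p l (p ^ m - 1) α (0, 0, 1) =
        puncturedWord p l (p ^ m - 1) α (1, 0, 0) := by
      funext t
      rw [puncturedWord_eq, puncturedWord_eq, trace_inv_pow_eq_of_minpoly_eq h]
      simp
    simpa using hU this
  have c23 : IsCoprime (minpoly (ZMod p) (α ^ 2)) (minpoly (ZMod p) (α ^ (p ^ l + 1))) := by
    refine (minpoly_coprime_or_eq _ _).resolve_right fun h => ?_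
    have : puncturedWord p l (p ^ m - 1) α (0, 1, 0) =
        puncturedWord p l (p ^ m - 1) α (1, 0, 0) := by
      funext t
      rw [puncturedWord_eq, puncturedWord_eq, trace_inv_pow_eq_of_minpoly_eq h]
      simp
    simpa using hU this
  have hh : minpoly (ZMod p) α * minpoly (ZMod p) (α ^ 2) *
      minpoly (ZMod p) (α ^ (p ^ l + 1)) ∣ X ^ (p ^ m - 1) - 1 :=
    (c13.mul_left c23).mul_dvd (c12.mul_dvd (hdvd _ hα.pow_eq_one) (hdvd _ (hpow 2)))
      (hdvd _ (hpow _))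
  -- The cyclic code has dimension at most the sum of three degrees, each at most `[F : K]`, while
  -- the injective image already has dimension `3[F : K]`.
  apply Submodule.eq_of_le_of_finrank_le
  · rintro _ ⟨v, rfl⟩
    have hsum : puncturedWord p l (p ^ m - 1) α v =
        (fun t : Fin (p ^ m - 1) =>
          Algebra.trace (ZMod p) F (v.1 * ((α ^ (p ^ l + 1)) ^ (t : ℕ))⁻¹)) +
        (fun t : Fin (p ^ m - 1) =>
          Algebra.trace (ZMod p) F (v.2.1 * ((α ^ 2) ^ (t : ℕ))⁻¹)) +
        (fun t : Fin (p ^ m - 1) => Algebra.trace (ZMod p) F (v.2.2 * (α ^ (t : ℕ))⁻¹)) :=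
      funext fun t => puncturedWord_eq α v t
    rw [hsum]
    refine Submodule.add_mem _ (Submodule.add_mem _ ?_ ?_) ?_
    · exact trace_word_mem_cyclicCode hn0 hα hh (hpow _) (by simp) _
    · exact trace_word_mem_cyclicCode hn0 hα hh (hpow _) (by simp) _
    · exact trace_word_mem_cyclicCode hn0 hα hh hα.pow_eq_one (by simp) _
  · refine (finrank_cyclicCode_le hn0 hh).trans ?_
    rw [LinearMap.finrank_range_of_inj hU, Module.finrank_prod, Module.finrank_prod]
    refine (natDegree_mul_le.trans (Nat.add_le_add_right natDegree_mul_le _)).trans ?_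
    have := minpoly.natDegree_le (A := ZMod p) α
    have := minpoly.natDegree_le (A := ZMod p) (α ^ 2)
    have := minpoly.natDegree_le (A := ZMod p) (α ^ (p ^ l + 1))
    omega

/-- An extended dual word is `d` followed by `-∑ d i`, so pairing it with `u` pairs `d` with `u i -
u n`, where `n` is the last position. The double dual then returns to `C`. -/
lemma mem_dualCode_extendedCode_dualCode_iff {K : Type*} [Field K] {n : ℕ}
    (C : Submodule K (Fin n → K)) (u : Fin (n + 1) → K) :
    u ∈ dualCode (extendedCode (dualCode C)) ↔
      (fun i : Fin n => u i.castSucc - u (Fin.last n)) ∈ C := by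
  constructor
  · intro hu
    rw [← dualCode_dualCode C]
    intro d hd
    have hmem : (Fin.snoc d (-∑ i, d i) : Fin (n + 1) → K) ∈ extendedCode (dualCode C) := by
      refine ⟨?_, ?_⟩
      · simpa using hd
      · simp [Fin.sum_univ_castSucc]
    have := hu _ hmem
    rw [Fin.sum_univ_castSucc] at this
    simp only [Fin.snoc_castSucc, Fin.snoc_last, neg_mul, sum_mul] at this
    simp only [mul_sub, sum_sub_distrib]
    rw [sub_eq_add_neg]
    exact this
  · rintro hu d ⟨hd, hd0⟩
    have h := hd _ hu
    rw [Fin.sum_univ_castSucc] at hd0 ⊢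
    simp only [sub_mul, sum_sub_distrib, ← mul_sum] at h
    rw [sum_congr rfl fun i _ => mul_comm (d (Fin.castSucc i)) _]
    linear_combination h + u (Fin.last n) * hd0

/-- The last coordinate is the value at `x = 0`, namely `h`; subtracting it leaves a punctured word
without constant term. -/
theorem map_traceCode_eq_dualCode (hinj : Function.Injective (traceWord (frobPow p l F)))
    (hF : Fintype.card F = p ^ m) {α : F} (hα : IsPrimitiveRoot α (p ^ m - 1)) :
    (traceCode p l F).map (LinearMap.funLeft (ZMod p) (ZMod p) (locator (p ^ m - 1) α)) =
      dualCode (extendedCode (dualCode (codeC1 p m l α))) := by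
  have hloc : ∀ i : Fin (p ^ m - 1), locator (p ^ m - 1) α i.castSucc = (α ^ (i : ℕ))⁻¹ := by
    intro i
    simp [locator]
  have hlast : locator (p ^ m - 1) α (Fin.last _) = 0 := by simp [locator]
  have hw0 : ∀ v : F × F × F × ZMod p, traceWord (frobPow p l F) v 0 = v.2.2.2 := by
    intro v; simp [traceWord_apply]
  ext u
  rw [mem_dualCode_extendedCode_dualCode_iff, ← range_puncturedWord hinj hF hα, traceCode_eq_range,
    LinearMap.mem_range, Submodule.mem_map]
  constructor
  · rintro ⟨_, ⟨v, rfl⟩, rfl⟩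
    refine ⟨(v.1, v.2.1, v.2.2.1), funext fun i => ?_⟩
    rw [puncturedWord_apply, LinearMap.funLeft_apply, LinearMap.funLeft_apply, hloc, hlast, hw0]
    simp only [traceWord_apply]
    ring
  · rintro ⟨v, hv⟩
    refine ⟨_, ⟨(v.1, v.2.1, v.2.2, u (Fin.last _)), rfl⟩, funext fun i => ?_⟩
    rw [LinearMap.funLeft_apply]
    induction i using Fin.lastCases with
    | last => rw [hlast, hw0]
    | cast i =>
      have := congrFun hv i
      rw [puncturedWord_apply] at this
      rw [hloc]
      simp only [traceWord_apply] at this ⊢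
      linear_combination this

end Duality

theorem theorem3p1 (p m l : ℕ) [Fact p.Prime] (hp : p ≠ 2) (hm : 3 ≤ m) (hl : 0 < l)
    (hml : Nat.gcd m l = 1)
    (F : Type*) [Field F] [Fintype F] [Algebra (ZMod p) F] (hF : Fintype.card F = p ^ m) :
    -- the trace code is the dual of the extended code of the dual of `C₁`
    (∀ α : F, IsPrimitiveRoot α (p ^ m - 1) →
      Function.Bijective (locator (p ^ m - 1) α) ∧
      (traceCode p l F).map (LinearMap.funLeft (ZMod p) (ZMod p) (locator (p ^ m - 1) α)) =
        dualCode (extendedCode (dualCode (codeC1 p m l α)))) ∧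
    -- dimension
    Module.finrank (ZMod p) (traceCode p l F) = 3 * m + 1 ∧
    -- weight distribution
    (Odd m → (∀ w : ℕ, (weightCount (traceCode p l F) w : ℚ) =
        tableMultiplicity (oddTable (p : ℚ) m) (w : ℚ)) ∧
      numNonzeroWeights (traceCode p l F) = if m = 3 then 7 else 8) ∧
    (Even m → (∀ w : ℕ, (weightCount (traceCode p l F) w : ℚ) =
        tableMultiplicity (evenTable (p : ℚ) m) (w : ℚ)) ∧
      numNonzeroWeights (traceCode p l F) = 10) := by
  classical
  have hpp : p.Prime := Fact.out
  have hK : ringChar (ZMod p) ≠ 2 := by rwa [ZMod.ringChar_zmod_n]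
  have hp3 : 3 ≤ p := by
    have := hpp.two_le
    omega
  have hfin : Module.finrank (ZMod p) F = m := by
    have h := Module.card_eq_pow_finrank (K := ZMod p) (V := F)
    rw [hF, ZMod.card] at h
    exact (Nat.pow_right_injective hpp.two_le h).symm
  have hσ := exists_algebraMap_of_frobPow_eq (F := F) hml hF
  have hm' : 3 ≤ Module.finrank (ZMod p) F := hfin.symm ▸ hm
  have hinj := traceWord_injective hK hσ hm'
  refine ⟨fun α hα => ⟨?_, map_traceCode_eq_dualCode hinj hF hα⟩, ?_, fun hodd => ?_,
    fun heven => ?_⟩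
  · refine locator_bijective ?_ hα
    have := Fintype.card_pos (α := F)
    omega
  · rw [traceCode_eq_range, finrank_range_traceWord hK hσ hm', hfin]
  · have hC : ∀ w : ℕ, (weightCount (traceCode p l F) w : ℚ) =
        tableMultiplicity (oddTable (p : ℚ) m) (w : ℚ) := by
      intro w
      have := weightCount_odd hK hσ hm' (by rwa [hfin]) w
      rwa [ZMod.card, hfin, ← traceCode_eq_range] at this
    refine ⟨hC, ?_⟩
    obtain ⟨j, rfl⟩ : ∃ j, m = 2 * j + 3 := by
      obtain ⟨k, hk⟩ := hodd
      exact ⟨k - 1, by omega⟩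
    rw [numNonzeroWeights_odd hp3 j hC]
    simp
  · have hC : ∀ w : ℕ, (weightCount (traceCode p l F) w : ℚ) =
        tableMultiplicity (evenTable (p : ℚ) m) (w : ℚ) := by
      intro w
      have := weightCount_even hK hσ hm' (by rwa [hfin]) w
      rwa [ZMod.card, hfin, ← traceCode_eq_range] at this
    refine ⟨hC, ?_⟩
    obtain ⟨j, rfl⟩ : ∃ j, m = 2 * j + 4 := by
      obtain ⟨k, hk⟩ := heven
      exact ⟨k - 2, by omega⟩
    exact numNonzeroWeights_even hp3 j hC
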